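/- Let $N,M$ be natural numbers and $j=\sqrt{-1}$. Let $\lambda>0$ (wavelength), $\sigma>0$ (noise power $\sigma^2$), $\beta_m>0$ (path losses), $K_m\ge 0$ (Rician factors) and real angles $\theta_m,\varphi_m$ be given for $m=1,\dots,M$, let $\boldsymbol\rho_m=(\sin\theta_m\cos\varphi_m,\cos\theta_m)^{\mathrm T}$, and let $\mathbf F\in\mathbb C^{N\times M}$, $\mathbf F\neq 0$, have columns $\mathbf f_1,\dots,\mathbf f_M$. For antenna positions $\mathbf T=[\mathbf t_1,\dots,\mathbf t_N]$, $\mathbf t_n\in\mathbb R^2$, let $\mathbf G_{\mathrm{LoS}}\in\mathbb C^{N\times M}$ have entries $e^{j\frac{2\pi}{\lambda}\mathbf t_n^{\mathrm T}\boldsymbol\rho_m}$, and put $$\mathbf\Lambda=\mathrm{diag}\Big(\tfrac{K_m\beta_m}{K_m+1}\Big),\quad \mathbf B=\mathbf\Lambda^{1/2}\mathbf G_{\mathrm{LoS}}^{\mathrm H}\mathbf F,\quad \mathbf D=\mathrm{diag}\Big(\tfrac{M\beta_m}{K_m+1}\Big),\quad \widetilde{\mathbf D}=\mathrm{diag}(\|\mathbf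 f_k\|^2).$$ For every $\mathbf T$ the system $\delta=\frac1M\mathrm{tr}(\mathbf D\mathbf\Gamma)$, $\tilde\delta=\frac1M\mathrm{tr}(\widetilde{\mathbf D}\widetilde{\mathbf\Gamma})$, where $$\mathbf\Phi=(\mathbf I+\tilde\delta\mathbf D)^{-1},\quad \widetilde{\mathbf\Phi}=(\mathbf I+\delta\widetilde{\mathbf D})^{-1},\quad \mathbf\Gamma=[\sigma^2\mathbf\Phi^{-1}+\mathbf B\widetilde{\mathbf\Phi}\mathbf B^{\mathrm H}]^{-1},\quad \widetilde{\mathbf\Gamma}=[\sigma^2\widetilde{\mathbf\Phi}^{-1}+\mathbf B^{\mathrm H}\mathbf\Phi\mathbf B]^{-1},$$ has a unique solution with $\delta,\tilde\delta>0$. Regard $\delta,\tilde\delta$, the matrices $\mathbf\Phi,\widetilde{\mathbf\Phi},\mathbf\Gamma,\widetilde{\mathbf\Gamma}$ at this solution, $\mathbf\Xi=\mathbf B\widetilde{\mathbf\Phi}\mathbf B^{\mathrm H}$ and $\widetilde{\mathbf\Xi}=\mathbf B^{\mathrm H}\mathbf\Phi\mathbf B$ as functions of $\mathbf T$, and let $$\overline{\mathcal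 R}_e(\mathbf T)=-\log|\sigma^2\mathbf\Gamma|+\log|\mathbf I+\delta\widetilde{\mathbf D}|-\sigma^2M\delta\tilde\delta$$ be the deterministic equivalent of the ergodic eavesdropper rate. Then for every $\mathbf T$, every $n$ and every $i\in\{1,2\}$, all these functions have partial derivatives with respect to the $i$-th entry $t_{n,i}$ of $\mathbf t_n$, denoted by $(\cdot)'_{(n,i)}$. The derivative of the $n$-th column $\tilde{\mathbf g}(\mathbf t_n)$ of $\mathbf G_{\mathrm{LoS}}^{\mathrm H}$ is the vector $\tilde{\mathbf g}'_{n,i}$ with entries $-j\frac{2\pi}{\lambda}[\boldsymbol\rho_m]_ie^{-j\frac{2\pi}{\lambda}\mathbf t_n^{\mathrm T}\boldsymbol\rho_m}$, $m=1,\dots,M$. The derivatives satisfy the linear fixed-point system $$\delta'_{(n,i)}=\tfrac1M\mathrm{tr}(\mathbf D\mathbf\Gamma'_{(n,i)}),\qquad \tilde\delta'_{(n,i)}=\tfrac1M\mathrm{tr}(\widetilde{\mathbf D}\widetilde{\mathbf\Gamma}'_{(n,i)}),$$ where $$\mathbf\Gamma'_{(n,i)}=-\mathbf\Gamma\big(\sigma^2\tilde\delta'_{(n,i)}\mathbf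 D+\mathbf\Xi'_{(n,i)}\big)\mathbf\Gamma,\qquad \widetilde{\mathbf\Gamma}'_{(n,i)}=-\widetilde{\mathbf\Gamma}\big(\sigma^2\delta'_{(n,i)}\widetilde{\mathbf D}+\widetilde{\mathbf\Xi}'_{(n,i)}\big)\widetilde{\mathbf\Gamma},$$ $$\mathbf\Phi'_{(n,i)}=-\mathbf\Phi(\tilde\delta'_{(n,i)}\mathbf D)\mathbf\Phi,\qquad \widetilde{\mathbf\Phi}'_{(n,i)}=-\widetilde{\mathbf\Phi}(\delta'_{(n,i)}\widetilde{\mathbf D})\widetilde{\mathbf\Phi},$$ $$\mathbf\Xi'_{(n,i)}=\mathbf B\widetilde{\mathbf\Phi}'_{(n,i)}\mathbf B^{\mathrm H}+2\Re\big(\mathbf\Lambda^{1/2}\tilde{\mathbf g}'_{n,i}\mathbf e_n^{\mathrm T}\mathbf F\widetilde{\mathbf\Phi}\mathbf B^{\mathrm H}\big),\qquad \widetilde{\mathbf\Xi}'_{(n,i)}=\mathbf B^{\mathrm H}\mathbf\Phi'_{(n,i)}\mathbf B+2\Re\big(\mathbf B^{\mathrm H}\mathbf\Phi\mathbf\Lambda^{1/2}\tilde{\mathbf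 g}'_{n,i}\mathbf e_n^{\mathrm T}\mathbf F\big),$$ with $2\Re(\mathbf X)=\mathbf X+\mathbf X^{\mathrm H}$ (twice the Hermitian part) and $\mathbf e_n$ the $n$-th standard basis vector. Moreover $\overline{\mathcal R}_e$ is differentiable in $\mathbf t_n$, and the $i$-th entry of its gradient with respect to $\mathbf t_n$ is $$[\nabla_{e,\mathbf t_n}]_i=-\mathrm{tr}\big(\mathbf\Gamma^{-1}\mathbf\Gamma'_{(n,i)}\big)+\delta'_{(n,i)}\,\mathrm{tr}\big(\widetilde{\mathbf\Phi}\widetilde{\mathbf D}\big)-\sigma^2M\big(\delta'_{(n,i)}\tilde\delta+\delta\tilde\delta'_{(n,i)}\big).$$ -/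

import Mathlib

open scoped Matrix

noncomputable section

namespace MIMOME

/-- Configuration of the positions of the `N` movable antennas: `T n` is the position in the
plane of antenna `n`. -/
abbrev Positions (N : ℕ) : Type := Fin N → EuclideanSpace ℝ (Fin 2)

/-- The fixed data of the eavesdropping system: `N` transmit antennas, `M` cooperating
single-antenna eavesdroppers and `M` data streams. -/
structure System (N M : ℕ) where
  /-- wavelength -/
  lam : ℝ
  /-- standard deviation of the noise (the noise power is `σ ^ 2`) -/
  σ : ℝ
  /-- path losses -/
  β : Fin M → ℝ
  /-- Rician factors -/
  K : Fin M → ℝ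
  /-- elevation angles of the line-of-sight paths -/
  θ : Fin M → ℝ
  /-- azimuth angles of the line-of-sight paths -/
  φ : Fin M → ℝ
  /-- precoding matrix -/
  F : Matrix (Fin N) (Fin M) ℂ

namespace System

variable {N M : ℕ} (S : System N M)

/-- The direction vector `ρ_m = (sin θ_m cos φ_m, cos θ_m)` of the `m`-th eavesdropper. -/
def rho (m : Fin M) : Fin 2 → ℝ :=
  ![Real.sin (S.θ m) * Real.cos (S.φ m), Real.cos (S.θ m)]

/-- The line-of-sight channel; its `m`-th column is the field-response vector with entries
`exp (j (2π/λ) t_nᵀ ρ_m)`. -/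
def GLoS (T : Positions N) : Matrix (Fin N) (Fin M) ℂ :=
  Matrix.of fun n m =>
    Complex.exp (Complex.I * ((2 * Real.pi / S.lam * ∑ i, T n i * S.rho m i : ℝ) : ℂ))

/-- The square root of `Λ = diag (K_m β_m / (K_m + 1))`. -/
def sqrtLambda : Matrix (Fin M) (Fin M) ℂ :=
  Matrix.diagonal fun m => ((Real.sqrt (S.K m * S.β m / (S.K m + 1)) : ℝ) : ℂ)

/-- `B = Λ^{1/2} G_LoSᴴ F`. -/
def B (T : Positions N) : Matrix (Fin M) (Fin M) ℂ :=
  S.sqrtLambda * (S.GLoS T)ᴴ * S.F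

/-- `D = diag (M β_m / (K_m + 1))`. -/
def D : Matrix (Fin M) (Fin M) ℂ :=
  Matrix.diagonal fun m => (((M : ℝ) * S.β m / (S.K m + 1) : ℝ) : ℂ)

/-- `D̃ = diag (‖f_k‖²)`, where `f_k` is the `k`-th column of `F`. -/
def Dt : Matrix (Fin M) (Fin M) ℂ :=
  Matrix.diagonal fun k => ((∑ n, ‖S.F n k‖ ^ 2 : ℝ) : ℂ)

/-- `Φ = (I + δ̃ D)⁻¹`, as a function of the scalar `δ̃ = y`. -/
def PhiOf (y : ℝ) : Matrix (Fin M) (Fin M) ℂ := (1 + (y : ℂ) • S.D)⁻¹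

/-- `Φ̃ = (I + δ D̃)⁻¹`, as a function of the scalar `δ = x`. -/
def PhitOf (x : ℝ) : Matrix (Fin M) (Fin M) ℂ := (1 + (x : ℂ) • S.Dt)⁻¹

/-- `Γ = [σ² Φ⁻¹ + B Φ̃ Bᴴ]⁻¹`, as a function of the positions and of `δ = x`, `δ̃ = y`. -/
def GamOf (T : Positions N) (x y : ℝ) : Matrix (Fin M) (Fin M) ℂ :=
  ((S.σ : ℂ) ^ 2 • (S.PhiOf y)⁻¹ + S.B T * S.PhitOf x * (S.B T)ᴴ)⁻¹

/-- `Γ̃ = [σ² Φ̃⁻¹ + Bᴴ Φ B]⁻¹`, as a function of the positions and of `δ = x`, `δ̃ = y`. -/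
def GamtOf (T : Positions N) (x y : ℝ) : Matrix (Fin M) (Fin M) ℂ :=
  ((S.σ : ℂ) ^ 2 • (S.PhitOf x)⁻¹ + (S.B T)ᴴ * S.PhiOf y * S.B T)⁻¹

/-- `p = (δ, δ̃)` is a positive solution, at the positions `T`, of
`δ = (1/M) tr (D Γ)`, `δ̃ = (1/M) tr (D̃ Γ̃)`. -/
def IsPositiveSolution (T : Positions N) (p : ℝ × ℝ) : Prop :=
  0 < p.1 ∧ 0 < p.2 ∧
    (p.1 : ℂ) = 1 / (M : ℂ) * (S.D * S.GamOf T p.1 p.2).trace ∧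
    (p.2 : ℂ) = 1 / (M : ℂ) * (S.Dt * S.GamtOf T p.1 p.2).trace

/-- The positive solution of the fixed-point system at the positions `T`. -/
def fixedPoint (T : Positions N) : ℝ × ℝ :=
  Classical.epsilon fun p => S.IsPositiveSolution T p

/-- `δ`, as a function of the positions. -/
def delta (T : Positions N) : ℝ := (S.fixedPoint T).1

/-- `δ̃`, as a function of the positions. -/
def deltat (T : Positions N) : ℝ := (S.fixedPoint T).2

/-- `Φ`, as a function of the positions. -/
def Phi (T : Positions N) : Matrix (Fin M) (Fin M) ℂ := S.PhiOf (S.deltat T)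

/-- `Φ̃`, as a function of the positions. -/
def Phit (T : Positions N) : Matrix (Fin M) (Fin M) ℂ := S.PhitOf (S.delta T)

/-- `Γ`, as a function of the positions. -/
def Gam (T : Positions N) : Matrix (Fin M) (Fin M) ℂ :=
  S.GamOf T (S.delta T) (S.deltat T)

/-- `Γ̃`, as a function of the positions. -/
def Gamt (T : Positions N) : Matrix (Fin M) (Fin M) ℂ :=
  S.GamtOf T (S.delta T) (S.deltat T)

/-- `Ξ = B Φ̃ Bᴴ`, as a function of the positions. -/
def Xi (T : Positions N) : Matrix (Fin M) (Fin M) ℂ := S.B T * S.Phit T * (S.B T)ᴴ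

/-- `Ξ̃ = Bᴴ Φ B`, as a function of the positions. -/
def Xit (T : Positions N) : Matrix (Fin M) (Fin M) ℂ := (S.B T)ᴴ * S.Phi T * S.B T

/-- The deterministic equivalent of the ergodic eavesdropper rate,
`-log |σ² Γ| + log |I + δ D̃| - σ² M δ δ̃`. Both matrices are Hermitian positive definite, so
their determinants are positive reals, and taking the real part only changes the type. -/
def rate (T : Positions N) : ℝ :=
  -Real.log ((S.σ : ℂ) ^ 2 • S.Gam T).det.re
    + Real.log (1 + (S.delta T : ℂ) • S.Dt).det.re
    - S.σ ^ 2 * M * S.delta T * S.deltat T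

/-- The vector `g̃'_{n,i}` with entries `-j (2π/λ) [ρ_m]_i exp (-j (2π/λ) t_nᵀ ρ_m)`. -/
def gtDeriv (T : Positions N) (n : Fin N) (i : Fin 2) : Fin M → ℂ := fun m =>
  -Complex.I * ((2 * Real.pi / S.lam * S.rho m i : ℝ) : ℂ) *
    Complex.exp (-Complex.I * ((2 * Real.pi / S.lam * ∑ k, T n k * S.rho m k : ℝ) : ℂ))

end System

/-- The unit direction in the space of positions that moves the `i`-th coordinate of antenna `n`
and nothing else. -/
def coordDir {N : ℕ} (n : Fin N) (i : Fin 2) : Positions N :=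
  Pi.single n (EuclideanSpace.single i (1 : ℝ))

/-- The matrix-valued function `A` of the positions has at `T`, entry by entry, the partial
derivative `A'` with respect to `t_{n,i}`. -/
def HasMatrixPartial {N M : ℕ} (A : Positions N → Matrix (Fin M) (Fin M) ℂ)
    (A' : Matrix (Fin M) (Fin M) ℂ) (T : Positions N) (n : Fin N) (i : Fin 2) : Prop :=
  ∀ a b, HasLineDerivAt ℝ (fun T' => A T' a b) (A' a b) T (coordDir n i)

/-- Twice the Hermitian part of a square matrix, `2 Re X = X + Xᴴ`. -/
def twoRe {M : ℕ} (X : Matrix (Fin M) (Fin M) ℂ) : Matrix (Fin M) (Fin M) ℂ := X + Xᴴ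

end MIMOME

end

/-! Write f(x, y) = (1/M) tr(D Γ) and g(y, x) = (1/M) tr(D̃ Γ̃) for δ = x, δ̃ = y. Both are
instances of one function `traceFun`: exchanging D with D̃ and B with Bᴴ carries one into the other.
Inversion reverses the Loewner order, so f grows with x and falls with y, and g behaves oppositely.
Hence (f, g) is monotone for the order "x up, y down"; it is also positive and bounded, and
Knaster-Tarski yields a positive solution. Uniqueness comes from the strict scaling f(αx, y/α) < α
f(x, y) for α > 1, and its analogue for g (`traceFun_scale`, `fixedPoint_le_of_mixedMonotone`).

The pointwise choice `fixedPoint` carries no regularity of its own, so differentiability is the main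
issue. The infinitesimal form of the scaling is the strict inequality x f_x - y f_y < f
(`exists_partials_traceFun`). At a solution f = x and g = y, so the Jacobian of (x - f, y - g)
becomes diagonally dominant after weighting its columns by x and y, and is invertible. The implicit
function theorem gives a local differentiable branch of solutions, and uniqueness identifies it with
`fixedPoint` (`differentiableAt_fixedPoint`).

After that the formulas are calculus along coordinate lines: the product rule, the derivative of an
inverse, and Jacobi's formula for the log-determinants. -/

noncomputable section

open scoped Matrix ComplexOrder Topology

namespace MIMOME

/-! ### Loewner order and the normalized trace function -/

section Order

/-- The complex diagonal matrix with the given real diagonal. -/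
def realDiag {ι : Type*} [DecidableEq ι] (p : ι → ℝ) : Matrix ι ι ℂ := Matrix.diagonal fun i => (p i : ℂ)

lemma posSemidef_realDiag {ι : Type*} [DecidableEq ι] {p : ι → ℝ}
    (hp : ∀ i, 0 ≤ p i) : (realDiag p).PosSemidef :=
  Matrix.PosSemidef.diagonal fun i => by simpa using hp i

lemma posSemidef_ofReal_smul {ι : Type*} {A : Matrix ι ι ℂ} (hA : A.PosSemidef) {x : ℝ} (hx : 0 ≤ x) :
    ((x : ℂ) • A).PosSemidef :=
  hA.smul (by simpa using hx)

lemma posDef_ofReal_smul {ι : Type*} {A : Matrix ι ι ℂ} (hA : A.PosDef) {x : ℝ} (hx : 0 < x) :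
    ((x : ℂ) • A).PosDef :=
  hA.smul (by simpa using hx)

/-- Conjugation reverses the product and cyclicity of the trace restores it. This is what moves the
equations, which are stated over ℂ, to ℝ. -/
lemma trace_mul_im_eq_zero {ι : Type*} [Fintype ι] {X Y : Matrix ι ι ℂ} (hX : X.IsHermitian) (hY : Y.IsHermitian) :
    (X * Y).trace.im = 0 := by
  rw [← Complex.conj_eq_iff_im, ← Complex.star_def, ← Matrix.trace_conjTranspose,
    Matrix.conjTranspose_mul, hX.eq, hY.eq, Matrix.trace_mul_comm]

variable {ι : Type*} [Fintype ι] [DecidableEq ι]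

lemma posDef_one_add_smul {p : ι → ℝ} (hp : ∀ i, 0 ≤ p i) {x : ℝ} (hx : 0 ≤ x) :
    (1 + (x : ℂ) • realDiag p).PosDef :=
  Matrix.PosDef.one.add_posSemidef (posSemidef_ofReal_smul (posSemidef_realDiag hp) hx)

/-- The resolvent identity expanded to second order. For Hermitian matrices both terms are
congruences, of B - A and of A⁻¹, so positivity can be read off without square roots. -/
lemma inv_sub_inv_eq {A B : Matrix ι ι ℂ} (hA : IsUnit A) (hB : IsUnit B) :
    A⁻¹ - B⁻¹ = B⁻¹ * (B - A) * B⁻¹ + B⁻¹ * (B - A) * A⁻¹ * (B - A) * B⁻¹ := by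
  have hA' := (Matrix.isUnit_iff_isUnit_det A).1 hA
  have hB' := (Matrix.isUnit_iff_isUnit_det B).1 hB
  have h1 : B⁻¹ * (B - A) = 1 - B⁻¹ * A := by
    rw [mul_sub, Matrix.nonsing_inv_mul _ hB']
  have h2 : (B - A) * B⁻¹ = 1 - A * B⁻¹ := by
    rw [sub_mul, Matrix.mul_nonsing_inv _ hB']
  have h3 : B⁻¹ * (B - A) * A⁻¹ = A⁻¹ - B⁻¹ := by
    rw [h1, sub_mul, one_mul, mul_assoc, Matrix.mul_nonsing_inv _ hA', mul_one]
  have h4 : A⁻¹ * ((B - A) * B⁻¹) = A⁻¹ - B⁻¹ := by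
    rw [h2, mul_sub, mul_one, ← mul_assoc, Matrix.nonsing_inv_mul _ hA', one_mul]
  rw [h3, mul_assoc (A⁻¹ - B⁻¹), sub_mul, h4, mul_assoc B⁻¹]
  abel

lemma posSemidef_inv_sub_inv {A B : Matrix ι ι ℂ} (hA : A.PosDef) (hB : B.PosDef)
    (h : (B - A).PosSemidef) : (A⁻¹ - B⁻¹).PosSemidef := by
  rw [inv_sub_inv_eq hA.isUnit hB.isUnit]
  have hBi : (B⁻¹)ᴴ = B⁻¹ := hB.inv.isHermitian
  have hd : (B - A)ᴴ = B - A := h.isHermitian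
  have h1 := h.mul_mul_conjTranspose_same B⁻¹
  have h2 := hA.inv.posSemidef.mul_mul_conjTranspose_same (B⁻¹ * (B - A))
  rw [hBi] at h1
  rw [Matrix.conjTranspose_mul, hBi, hd, ← mul_assoc] at h2
  exact h1.add h2

/-- Strictness comes from the first-order term alone: it is the congruence of a positive definite
matrix by the invertible B⁻¹. -/
lemma posDef_inv_sub_inv {A B : Matrix ι ι ℂ} (hA : A.PosDef) (hB : B.PosDef)
    (h : (B - A).PosDef) : (A⁻¹ - B⁻¹).PosDef := by
  rw [inv_sub_inv_eq hA.isUnit hB.isUnit]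
  have hBi : (B⁻¹)ᴴ = B⁻¹ := hB.inv.isHermitian
  have hd : (B - A)ᴴ = B - A := h.isHermitian
  have h1 : (B⁻¹ * (B - A) * (B⁻¹)ᴴ).PosDef :=
    h.mul_mul_conjTranspose_same
      (Matrix.vecMul_injective_of_isUnit hB.inv.isUnit)
  have h2 := hA.inv.posSemidef.mul_mul_conjTranspose_same (B⁻¹ * (B - A))
  rw [hBi] at h1
  rw [Matrix.conjTranspose_mul, hBi, hd, ← mul_assoc] at h2
  exact h1.add_posSemidef h2

lemma trace_realDiag_mul (p : ι → ℝ) (X : Matrix ι ι ℂ) :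
    (realDiag p * X).trace = ∑ i, (p i : ℂ) * X i i := by
  simp [realDiag, Matrix.trace, Matrix.diagonal_mul]

lemma trace_realDiag_mul_re (p : ι → ℝ) (X : Matrix ι ι ℂ) :
    (realDiag p * X).trace.re = ∑ i, p i * (X i i).re := by
  simp [trace_realDiag_mul]

lemma trace_realDiag_mul_nonneg {p : ι → ℝ} (hp : ∀ i, 0 ≤ p i) {X : Matrix ι ι ℂ}
    (hX : X.PosSemidef) : 0 ≤ (realDiag p * X).trace.re := by
  rw [trace_realDiag_mul_re]
  exact Finset.sum_nonneg fun i _ =>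
    mul_nonneg (hp i) (Complex.le_def.1 (hX.diag_nonneg (i := i))).1

lemma trace_realDiag_mul_pos {p : ι → ℝ} (hp : ∀ i, 0 ≤ p i) (hp0 : ∃ i, 0 < p i)
    {X : Matrix ι ι ℂ} (hX : X.PosDef) : 0 < (realDiag p * X).trace.re := by
  rw [trace_realDiag_mul_re]
  obtain ⟨i, hi⟩ := hp0
  exact Finset.sum_pos' (fun i _ =>
    mul_nonneg (hp i) (Complex.le_def.1 (hX.posSemidef.diag_nonneg (i := i))).1)
    ⟨i, Finset.mem_univ i, mul_pos hi (Complex.lt_def.1 (hX.diag_pos (i := i))).1⟩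

/-- The matrix `s (1 + y P) + A (1 + x Q)⁻¹ Aᴴ` with `P`, `Q` real diagonal. -/
def pencil (s : ℝ) (p q : ι → ℝ) (A : Matrix ι ι ℂ) (x y : ℝ) : Matrix ι ι ℂ :=
  (s : ℂ) • (1 + (y : ℂ) • realDiag p) + A * (1 + (x : ℂ) • realDiag q)⁻¹ * Aᴴ

/-- The normalized trace `c tr (P R)`, where `R` is the inverse of the pencil. -/
def traceFun (c s : ℝ) (p q : ι → ℝ) (A : Matrix ι ι ℂ) (x y : ℝ) : ℝ :=
  c * (realDiag p * (pencil s p q A x y)⁻¹).trace.re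

variable {c s : ℝ} {p q : ι → ℝ} {A : Matrix ι ι ℂ}

lemma posDef_pencil (hs : 0 < s) (hp : ∀ i, 0 ≤ p i) (hq : ∀ i, 0 ≤ q i) {x y : ℝ}
    (hx : 0 ≤ x) (hy : 0 ≤ y) : (pencil s p q A x y).PosDef :=
  (posDef_ofReal_smul (posDef_one_add_smul hp hy) hs).add_posSemidef
    ((posDef_one_add_smul hq hx).inv.posSemidef.mul_mul_conjTranspose_same A)

lemma traceFun_pos (hc : 0 < c) (hs : 0 < s) (hp : ∀ i, 0 ≤ p i) (hp0 : ∃ i, 0 < p i)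
    (hq : ∀ i, 0 ≤ q i) {x y : ℝ} (hx : 0 ≤ x) (hy : 0 ≤ y) : 0 < traceFun c s p q A x y :=
  mul_pos hc (trace_realDiag_mul_pos hp hp0 (posDef_pencil hs hp hq hx hy).inv)

/-- Raising x shrinks (1 + xQ)⁻¹ and lowering y shrinks 1 + yP, so the pencil decreases and its
inverse increases; the trace against P ≥ 0 preserves this. -/
lemma traceFun_mono (hc : 0 < c) (hs : 0 < s) (hp : ∀ i, 0 ≤ p i)
    (hq : ∀ i, 0 ≤ q i) {x y x' y' : ℝ} (hx : 0 ≤ x) (hxx : x ≤ x') (hy' : 0 ≤ y')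
    (hyy : y' ≤ y) : traceFun c s p q A x y ≤ traceFun c s p q A x' y' := by
  have h1 : ((1 + (x : ℂ) • realDiag q)⁻¹ - (1 + (x' : ℂ) • realDiag q)⁻¹).PosSemidef := by
    refine posSemidef_inv_sub_inv (posDef_one_add_smul hq hx)
      (posDef_one_add_smul hq (hx.trans hxx)) ?_
    have := posSemidef_ofReal_smul (posSemidef_realDiag hq) (sub_nonneg.2 hxx)
    convert this using 1
    rw [Complex.ofReal_sub, sub_smul]; abel
  have h2 : (pencil s p q A x y - pencil s p q A x' y').PosSemidef := by
    have h3 := (posSemidef_ofReal_smul (posSemidef_ofReal_smul (posSemidef_realDiag hp)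
      (sub_nonneg.2 hyy)) hs.le).add (h1.mul_mul_conjTranspose_same A)
    convert h3 using 1
    simp only [pencil, Complex.ofReal_sub, sub_smul, mul_sub, sub_mul, smul_sub, smul_add]
    abel
  have h4 := trace_realDiag_mul_nonneg hp (posSemidef_inv_sub_inv
    (posDef_pencil hs hp hq (hx.trans hxx) hy') (posDef_pencil hs hp hq hx (hy'.trans hyy)) h2)
  rw [mul_sub, Matrix.trace_sub, Complex.sub_re] at h4
  exact mul_le_mul_of_nonneg_left (by linarith) hc.le

/-- Subtracting α⁻¹ times the pencil at (x, y) from the pencil at (αx, y/α) cancels the P-terms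
exactly. What remains is s(1 - α⁻¹) times the identity, which makes the inequality strict, plus a
positive semidefinite term. -/
lemma traceFun_scale (hc : 0 < c) (hs : 0 < s) (hp : ∀ i, 0 ≤ p i) (hp0 : ∃ i, 0 < p i)
    (hq : ∀ i, 0 ≤ q i) {x y α : ℝ} (hx : 0 ≤ x) (hy : 0 ≤ y) (hα : 1 < α) :
    traceFun c s p q A (α * x) (y / α) < α * traceFun c s p q A x y := by
  have hα0 : 0 < α := by linarith
  have hαc : (α : ℂ) ≠ 0 := by exact_mod_cast hα0.ne'
  have hαx : 0 ≤ α * x := by positivity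
  have hyα : 0 ≤ y / α := by positivity
  have hinv : ∀ X : Matrix ι ι ℂ, X.PosDef → (((α⁻¹ : ℝ) : ℂ) • X)⁻¹ = (α : ℂ) • X⁻¹ := by
    intro X hX
    apply Matrix.inv_eq_left_inv
    rw [Matrix.smul_mul, Matrix.mul_smul, smul_smul,
      Matrix.nonsing_inv_mul _ ((Matrix.isUnit_iff_isUnit_det X).1 hX.isUnit)]
    simp [hαc]
  have hinv' : ∀ X : Matrix ι ι ℂ, X.PosDef → ((α : ℂ) • X)⁻¹ = ((α⁻¹ : ℝ) : ℂ) • X⁻¹ := by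
    intro X hX
    apply Matrix.inv_eq_left_inv
    rw [Matrix.smul_mul, Matrix.mul_smul, smul_smul,
      Matrix.nonsing_inv_mul _ ((Matrix.isUnit_iff_isUnit_det X).1 hX.isUnit)]
    simp [hαc]
  have h1 : ((1 + ((α * x : ℝ) : ℂ) • realDiag q)⁻¹ -
      ((α⁻¹ : ℝ) : ℂ) • (1 + (x : ℂ) • realDiag q)⁻¹).PosSemidef := by
    rw [← hinv' _ (posDef_one_add_smul hq hx)]
    refine posSemidef_inv_sub_inv (posDef_one_add_smul hq hαx)
      (posDef_ofReal_smul (posDef_one_add_smul hq hx) hα0) ?_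
    -- Here α(1 + xQ) - (1 + αxQ) = (α - 1) I.
    have := posSemidef_ofReal_smul (Matrix.PosSemidef.one (n := ι) (R := ℂ)) (sub_nonneg.2 hα.le)
    convert this using 1
    simp only [Complex.ofReal_sub, sub_smul, Complex.ofReal_mul, smul_add, smul_smul,
      Complex.ofReal_one, one_smul]
    abel
  have hα1 : 0 < s * (1 - α⁻¹) := mul_pos hs (sub_pos.2 (inv_lt_one_of_one_lt₀ hα))
  have h2 : (pencil s p q A (α * x) (y / α) - ((α⁻¹ : ℝ) : ℂ) • pencil s p q A x y).PosDef := by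
    have h3 := (posDef_ofReal_smul (Matrix.PosDef.one (n := ι) (R := ℂ)) hα1).add_posSemidef
      (h1.mul_mul_conjTranspose_same A)
    convert h3 using 1
    have e1 : ((y / α : ℝ) : ℂ) = ((α⁻¹ : ℝ) : ℂ) * (y : ℂ) := by
      push_cast; rw [div_eq_inv_mul]
    simp only [pencil, e1, Complex.ofReal_sub, Complex.ofReal_mul, sub_smul, mul_sub, sub_mul,
      smul_add, smul_smul, Matrix.mul_smul, Matrix.smul_mul, mul_one]
    rw [show (s : ℂ) * (((α⁻¹ : ℝ) : ℂ) * (y : ℂ)) = ((α⁻¹ : ℝ) : ℂ) * ((s : ℂ) * y) by ring,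
      mul_comm (s : ℂ) ((α⁻¹ : ℝ) : ℂ)]
    abel
  have hA := posDef_pencil (A := A) hs hp hq hx hy
  have h4 := trace_realDiag_mul_pos hp hp0 (posDef_inv_sub_inv
    (posDef_ofReal_smul hA (inv_pos.2 hα0)) (posDef_pencil hs hp hq hαx hyα) h2)
  rw [hinv _ hA, mul_sub, Matrix.trace_sub, Complex.sub_re, Matrix.mul_smul, Matrix.trace_smul,
    smul_eq_mul, Complex.re_ofReal_mul] at h4
  have := mul_lt_mul_of_pos_left (sub_pos.1 h4) hc
  unfold traceFun
  linarith

/-- The pencil dominates sI. The resulting bound does not depend on x, y, which confines the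
fixed-point problem to a box. -/
lemma traceFun_le (hc : 0 < c) (hs : 0 < s) (hp : ∀ i, 0 ≤ p i)
    (hq : ∀ i, 0 ≤ q i) {x y : ℝ} (hx : 0 ≤ x) (hy : 0 ≤ y) :
    traceFun c s p q A x y ≤
      c * (realDiag p * ((s : ℂ) • (1 : Matrix ι ι ℂ))⁻¹).trace.re := by
  have h2 : (pencil s p q A x y - (s : ℂ) • (1 : Matrix ι ι ℂ)).PosSemidef := by
    have h3 := (posSemidef_ofReal_smul (posSemidef_ofReal_smul (posSemidef_realDiag hp)
      hy) hs.le).add ((posDef_one_add_smul hq hx).inv.posSemidef.mul_mul_conjTranspose_same A)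
    convert h3 using 1
    simp only [pencil, smul_add]
    abel
  have h4 := trace_realDiag_mul_nonneg hp (posSemidef_inv_sub_inv
    (posDef_ofReal_smul Matrix.PosDef.one hs) (posDef_pencil hs hp hq hx hy) h2)
  rw [mul_sub, Matrix.trace_sub, Complex.sub_re] at h4
  exact mul_le_mul_of_nonneg_left (by linarith) hc.le

end Order

/-! ### Mixed monotone systems in two real unknowns -/

section FixedPoint

variable {f g : ℝ → ℝ → ℝ}

/-- Existence for a mixed monotone system, by the Knaster-Tarski theorem for the product of the
usual order and the reversed order. -/
lemma exists_fixedPoint_of_mixedMonotone {a b : ℝ}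
    (hf0 : ∀ x y, 0 ≤ x → 0 ≤ y → 0 < f x y) (hg0 : ∀ x y, 0 ≤ x → 0 ≤ y → 0 < g x y)
    (hfa : ∀ x y, 0 ≤ x → 0 ≤ y → f x y ≤ a) (hgb : ∀ x y, 0 ≤ x → 0 ≤ y → g x y ≤ b)
    (hf : ∀ x y x' y', 0 ≤ x → x ≤ x' → 0 ≤ y' → y' ≤ y → f x y ≤ f x' y')
    (hg : ∀ x y x' y', 0 ≤ x → x ≤ x' → 0 ≤ y' → y' ≤ y → g x y ≤ g x' y') :
    ∃ p : ℝ × ℝ, 0 < p.1 ∧ 0 < p.2 ∧ p.1 = f p.1 p.2 ∧ p.2 = g p.2 p.1 := by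
  have ha : (0 : ℝ) ≤ a := (hf0 0 0 le_rfl le_rfl).le.trans (hfa 0 0 le_rfl le_rfl)
  have hb : (0 : ℝ) ≤ b := (hg0 0 0 le_rfl le_rfl).le.trans (hgb 0 0 le_rfl le_rfl)
  have : Fact ((0 : ℝ) ≤ a) := ⟨ha⟩
  have : Fact ((0 : ℝ) ≤ b) := ⟨hb⟩
  let r : (Set.Icc (0 : ℝ) b)ᵒᵈ → Set.Icc (0 : ℝ) b := OrderDual.ofDual
  let F : (Set.Icc (0 : ℝ) a × (Set.Icc (0 : ℝ) b)ᵒᵈ) →o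
      (Set.Icc (0 : ℝ) a × (Set.Icc (0 : ℝ) b)ᵒᵈ) :=
    { toFun := fun z =>
        (⟨f z.1 (r z.2), (hf0 _ _ z.1.2.1 (r z.2).2.1).le,
          hfa _ _ z.1.2.1 (r z.2).2.1⟩,
        OrderDual.toDual ⟨g (r z.2) z.1,
          (hg0 _ _ (r z.2).2.1 z.1.2.1).le,
          hgb _ _ (r z.2).2.1 z.1.2.1⟩)
      monotone' := by
        rintro ⟨x, y⟩ ⟨x', y'⟩ ⟨h1, h2⟩
        exact ⟨hf _ _ _ _ x.2.1 h1 (r y').2.1 h2,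
          hg _ _ _ _ (r y').2.1 h2 x.2.1 h1⟩ }
  have h := F.map_lfp
  set z := OrderHom.lfp F
  have h1 : f z.1 (r z.2) = z.1 := congrArg (fun w => (w.1 : ℝ)) h
  have h2 : g (r z.2) z.1 = (r z.2 : ℝ) :=
    congrArg (fun w : Set.Icc (0 : ℝ) a × (Set.Icc (0 : ℝ) b)ᵒᵈ => (r w.2 : ℝ)) h
  -- The box contains 0, but f and g are strictly positive on all of it, so the fixed point cannot
  -- lie on the axes.
  refine ⟨(z.1, (r z.2 : ℝ)), ?_, ?_, h1.symm, h2.symm⟩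
  · rw [← h1]; exact hf0 _ _ z.1.2.1 (r z.2).2.1
  · rw [← h2]; exact hg0 _ _ (r z.2).2.1 z.1.2.1

/-- Two positive solutions of a mixed monotone system that scales strictly sublinearly are
comparable, in both directions. -/
lemma fixedPoint_le_of_mixedMonotone
    (hf : ∀ x y x' y', 0 ≤ x → x ≤ x' → 0 ≤ y' → y' ≤ y → f x y ≤ f x' y')
    (hg : ∀ x y x' y', 0 ≤ x → x ≤ x' → 0 ≤ y' → y' ≤ y → g x y ≤ g x' y')
    (hfs : ∀ x y α, 0 ≤ x → 0 ≤ y → 1 < α → f (α * x) (y / α) < α * f x y)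
    (hgs : ∀ x y α, 0 ≤ x → 0 ≤ y → 1 < α → g (α * x) (y / α) < α * g x y)
    {x y x' y' : ℝ} (hx : 0 < x) (hy : 0 < y) (hx' : 0 < x') (hy' : 0 < y')
    (h1 : x = f x y) (h2 : y = g y x) (h1' : x' = f x' y') (h2' : y' = g y' x') :
    x' ≤ x ∧ y ≤ y' := by
  -- The least α with x' ≤ αx and y ≤ αy'. If α > 1, strict scaling makes both inequalities strict,
  -- contradicting minimality.
  set α := max (x' / x) (y / y') with hα
  by_cases hα1 : α ≤ 1
  · have e1 := (le_max_left (x' / x) (y / y')).trans hα1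
    have e2 := (le_max_right (x' / x) (y / y')).trans hα1
    exact ⟨(div_le_one hx).1 e1, (div_le_one hy').1 e2⟩
  push Not at hα1
  have hα0 : 0 < α := by linarith
  have e1 : x' ≤ α * x := (div_le_iff₀ hx).1 (le_max_left (x' / x) (y / y'))
  have e2 : y ≤ α * y' := (div_le_iff₀ hy').1 (le_max_right (x' / x) (y / y'))
  have e3 : y / α ≤ y' := (div_le_iff₀' hα0).2 e2
  have k1 : x' < α * x := by
    have := hf x' y' (α * x) (y / α) hx'.le e1 (by positivity) e3
    have h3 := hfs x y α hx.le hy.le hα1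
    rw [← h1] at h3; rw [← h1'] at this
    linarith
  have k2 : y < α * y' := by
    have := hg (y / α) (α * x) y' x' (by positivity) e3 hx'.le e1
    -- Scaling starts from (y/α, αx), so that the scaled point is the solution (y, x) itself.
    have h3 := hgs (y / α) (α * x) α (by positivity) (by positivity) hα1
    rw [mul_div_cancel₀ _ hα0.ne', mul_div_cancel_left₀ _ hα0.ne', ← h2] at h3
    rw [← h2'] at this
    nlinarith
  have k3 : α < α := max_lt ((div_lt_iff₀ hx).2 k1) ((div_lt_iff₀ hy').2 k2)
  exact absurd k3 (lt_irrefl _)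

end FixedPoint

/-! ### Existence and uniqueness for the trace system -/

section

variable {ι : Type*} [Fintype ι] [DecidableEq ι] {c s : ℝ} {p q : ι → ℝ}

lemma existsUnique_traceFun_fixedPoint (A : Matrix ι ι ℂ) (hc : 0 < c) (hs : 0 < s)
    (hp : ∀ i, 0 ≤ p i) (hp0 : ∃ i, 0 < p i) (hq : ∀ i, 0 ≤ q i) (hq0 : ∃ i, 0 < q i) :
    ∃! z : ℝ × ℝ, 0 < z.1 ∧ 0 < z.2 ∧ z.1 = traceFun c s p q A z.1 z.2 ∧
      z.2 = traceFun c s q p Aᴴ z.2 z.1 := by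
  have hf := fun x y x' y' h1 h2 h3 h4 =>
    traceFun_mono (A := A) (x := x) (y := y) (x' := x') (y' := y') hc hs hp hq h1 h2 h3 h4
  have hg := fun x y x' y' h1 h2 h3 h4 =>
    traceFun_mono (A := Aᴴ) (x := x) (y := y) (x' := x') (y' := y') hc hs hq hp h1 h2 h3 h4
  have hfs := fun x y α h1 h2 h3 =>
    traceFun_scale (A := A) (x := x) (y := y) (α := α) hc hs hp hp0 hq h1 h2 h3
  have hgs := fun x y α h1 h2 h3 =>
    traceFun_scale (A := Aᴴ) (x := x) (y := y) (α := α) hc hs hq hq0 hp h1 h2 h3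
  obtain ⟨z, hz⟩ := exists_fixedPoint_of_mixedMonotone
    (fun x y h1 h2 => traceFun_pos (A := A) hc hs hp hp0 hq h1 h2)
    (fun x y h1 h2 => traceFun_pos (A := Aᴴ) hc hs hq hq0 hp h1 h2)
    (fun x y h1 h2 => traceFun_le hc hs hp hq h1 h2)
    (fun x y h1 h2 => traceFun_le hc hs hq hp h1 h2) hf hg
  refine ⟨z, hz, fun w hw => ?_⟩
  obtain ⟨z1, z2, z3, z4⟩ := hz
  obtain ⟨w1, w2, w3, w4⟩ := hw
  have k1 := fixedPoint_le_of_mixedMonotone hf hg hfs hgs z1 z2 w1 w2 z3 z4 w3 w4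
  have k2 := fixedPoint_le_of_mixedMonotone hf hg hfs hgs w1 w2 z1 z2 w3 w4 z3 z4
  exact Prod.ext (le_antisymm k1.1 k2.1) (le_antisymm k2.2 k1.2)

end

/-! ### Calculus of matrix-valued functions -/

section Calculus

-- A submultiplicative norm makes the matrices a complete normed algebra, so the calculus of ring
-- inversion applies.
attribute [local instance] Matrix.linftyOpNormedRing Matrix.linftyOpNormedAlgebra

variable {ι : Type*} [Fintype ι] [DecidableEq ι]

/-- The entry of a complex matrix, as a real continuous linear map. -/
def entryCLM (i j : ι) : Matrix ι ι ℂ →L[ℝ] ℂ :=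
  LinearMap.toContinuousLinearMap (Matrix.entryLinearMap ℝ ℂ i j)

/-- The trace of a complex matrix, as a real continuous linear map. -/
def traceCLM : Matrix ι ι ℂ →L[ℝ] ℂ :=
  LinearMap.toContinuousLinearMap (Matrix.traceLinearMap ι ℝ ℂ)

lemma hasDerivAt_matrix_iff {X : ℝ → Matrix ι ι ℂ} {X' : Matrix ι ι ℂ} {t : ℝ} :
    HasDerivAt X X' t ↔ ∀ i j, HasDerivAt (fun u => X u i j) (X' i j) t := by
  refine ⟨fun h i j => (entryCLM i j).hasFDerivAt.comp_hasDerivAt t h, fun h => ?_⟩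
  have h1 : HasDerivAt (fun u => ∑ i, ∑ j, X u i j • Matrix.single i j (1 : ℂ))
      (∑ i, ∑ j, X' i j • Matrix.single i j (1 : ℂ)) t :=
    HasDerivAt.fun_sum fun i _ => HasDerivAt.fun_sum fun j _ => (h i j).smul_const _
  have h2 : ∀ Y : Matrix ι ι ℂ, ∑ i, ∑ j, Y i j • Matrix.single i j (1 : ℂ) = Y := by
    intro Y
    conv_rhs => rw [Matrix.matrix_eq_sum_single Y]
    simp [Matrix.smul_single]
  simpa only [h2] using h1

lemma contDiffAt_matrix {E : Type*} [NormedAddCommGroup E] [NormedSpace ℝ E]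
    {X : E → Matrix ι ι ℂ} {e : E} {n : ℕ∞} (h : ∀ i j, ContDiffAt ℝ n (fun u => X u i j) e) :
    ContDiffAt ℝ n X e := by
  have h1 : ContDiffAt ℝ n (fun u => ∑ i, ∑ j, X u i j • Matrix.single i j (1 : ℂ)) e :=
    ContDiffAt.sum fun i _ => ContDiffAt.sum fun j _ => (h i j).smul contDiffAt_const
  have h2 : ∀ Y : Matrix ι ι ℂ, ∑ i, ∑ j, Y i j • Matrix.single i j (1 : ℂ) = Y := by
    intro Y
    conv_rhs => rw [Matrix.matrix_eq_sum_single Y]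
    simp [Matrix.smul_single]
  simpa only [h2] using h1

lemma contDiffAt_matrix_entry {E : Type*} [NormedAddCommGroup E] [NormedSpace ℝ E]
    {X : E → Matrix ι ι ℂ} {e : E} {n : ℕ∞} (h : ContDiffAt ℝ n X e) (i j : ι) :
    ContDiffAt ℝ n (fun u => X u i j) e :=
  (entryCLM i j).contDiff.contDiffAt.comp e h

lemma contDiffAt_matrix_inv {E : Type*} [NormedAddCommGroup E] [NormedSpace ℝ E]
    {X : E → Matrix ι ι ℂ} {e : E} {n : ℕ∞} (h : ContDiffAt ℝ n X e) (hX : IsUnit (X e)) :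
    ContDiffAt ℝ n (fun u => (X u)⁻¹) e := by
  simp only [Matrix.nonsing_inv_eq_ringInverse]
  obtain ⟨U, hU⟩ := hX
  have := contDiffAt_ringInverse ℝ U (n := n)
  rw [hU] at this
  exact this.comp e h

lemma hasDerivAt_matrix_inv {X : ℝ → Matrix ι ι ℂ} {X' : Matrix ι ι ℂ} {t : ℝ}
    (h : HasDerivAt X X' t) (hX : IsUnit (X t)) :
    HasDerivAt (fun u => (X u)⁻¹) (-((X t)⁻¹ * X' * (X t)⁻¹)) t := by
  simp only [Matrix.nonsing_inv_eq_ringInverse]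
  obtain ⟨U, hU⟩ := hX
  have := hasFDerivAt_ringInverse (𝕜 := ℝ) U
  rw [hU] at this
  have h2 := this.comp_hasDerivAt t h
  refine h2.congr_deriv ?_
  rw [← hU, Ring.inverse_unit]
  simp

lemma hasDerivAt_conjTranspose {X : ℝ → Matrix ι ι ℂ} {X' : Matrix ι ι ℂ} {t : ℝ}
    (h : HasDerivAt X X' t) : HasDerivAt (fun u => (X u)ᴴ) (X'ᴴ) t :=
  hasDerivAt_matrix_iff.2 fun i j => (hasDerivAt_matrix_iff.1 h j i).star

lemma contDiffAt_conjTranspose {E : Type*} [NormedAddCommGroup E] [NormedSpace ℝ E]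
    {X : E → Matrix ι ι ℂ} {e : E} {n : ℕ∞} (h : ContDiffAt ℝ n X e) :
    ContDiffAt ℝ n (fun u => (X u)ᴴ) e :=
  contDiffAt_matrix fun i j => by
    simpa [Function.comp_def] using
      Complex.conjCLE.contDiff.contDiffAt.comp e (contDiffAt_matrix_entry h j i)

lemma contDiffAt_det {E : Type*} [NormedAddCommGroup E] [NormedSpace ℝ E]
    {X : E → Matrix ι ι ℂ} {e : E} {n : ℕ∞} (h : ContDiffAt ℝ n X e) :
    ContDiffAt ℝ n (fun u => (X u).det) e := by
  simp only [Matrix.det_apply']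
  exact ContDiffAt.sum fun σ _ => contDiffAt_const.mul
    (contDiffAt_prod fun i _ => contDiffAt_matrix_entry h _ _)

/-- Jacobi's formula for the derivative of a determinant. -/
lemma hasDerivAt_det {X : ℝ → Matrix ι ι ℂ} {X' : Matrix ι ι ℂ} {t : ℝ}
    (h : HasDerivAt X X' t) (hX : IsUnit (X t)) :
    HasDerivAt (fun u => (X u).det) ((X t).det * ((X t)⁻¹ * X').trace) t := by
  -- The determinant is polynomial in the entries, hence differentiable. Its derivative in the
  -- direction X' can therefore be computed on the straight line X t + u X' instead of the given
  -- curve.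
  have hdet : DifferentiableAt ℝ (fun Y : Matrix ι ι ℂ => Y.det) (X t) :=
    (contDiffAt_det (n := 1) (X := fun Y : Matrix ι ι ℂ => Y) contDiffAt_id).differentiableAt
      (by simp)
  have h1 := hdet.hasFDerivAt.comp_hasDerivAt t h
  have hline : HasDerivAt (fun u : ℝ => X t + (u : ℂ) • X') X' 0 := by
    have := ((Complex.ofRealCLM.hasDerivAt (x := (0 : ℝ))).smul_const X').const_add (X t)
    refine this.congr_deriv ?_
    simp
  have h2 : HasDerivAt (fun u : ℝ => (X t + (u : ℂ) • X').det)
      (fderiv ℝ (fun Y : Matrix ι ι ℂ => Y.det) (X t) X') 0 := by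
    have h3 : HasFDerivAt (fun Y : Matrix ι ι ℂ => Y.det)
      (fderiv ℝ (fun Y : Matrix ι ι ℂ => Y.det) (X t)) (X t + ((0 : ℝ) : ℂ) • X') := by
      simpa using hdet.hasFDerivAt
    exact h3.comp_hasDerivAt (0 : ℝ) hline
  have hXd := (Matrix.isUnit_iff_isUnit_det (X t)).1 hX
  have h4 : HasDerivAt (fun u : ℝ => (X t + (u : ℂ) • X').det)
      ((X t).det * ((X t)⁻¹ * X').trace) 0 := by
    -- Factor out det (X t) and expand det (1 + uY) = 1 + u tr Y + u² P(u) with Y = (X t)⁻¹ X'. The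
    -- polynomial P is irrelevant to the derivative at 0.
    have e : ∀ u : ℝ, (X t + (u : ℂ) • X').det = (X t).det * (1 +
        ((X t)⁻¹ * X').trace * (u : ℂ) +
        ((1 + (Polynomial.X : Polynomial ℂ) • ((X t)⁻¹ * X').map Polynomial.C).det.divX.divX.eval
          (u : ℂ)) * (u : ℂ) ^ 2) := by
      intro u
      rw [← Matrix.det_one_add_smul, ← Matrix.det_mul, mul_add, mul_one, Matrix.mul_smul,
        ← mul_assoc, Matrix.mul_nonsing_inv _ hXd, one_mul]
    simp only [e]
    generalize (1 + (Polynomial.X : Polynomial ℂ) •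
      ((X t)⁻¹ * X').map Polynomial.C).det.divX.divX = P
    have hu := (Complex.ofRealCLM.hasDerivAt (x := (0 : ℝ)))
    have hP : HasDerivAt (fun u : ℝ => P.eval (u : ℂ)) _ 0 :=
      HasDerivAt.comp_ofReal (z := 0) (P.hasDerivAt ((0 : ℝ) : ℂ))
    have := (((hu.const_mul ((X t)⁻¹ * X').trace).const_add 1).add
      (hP.mul (hu.pow 2))).const_mul (X t).det
    refine this.congr_deriv ?_
    simp
  rw [← h2.unique h4]
  exact h1

end Calculus

/-! ### Smoothness and partial derivatives of the trace function -/

section Smoothness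

attribute [local instance] Matrix.linftyOpNormedRing Matrix.linftyOpNormedAlgebra

variable {ι : Type*} [Fintype ι] [DecidableEq ι]
variable {E : Type*} [NormedAddCommGroup E] [NormedSpace ℝ E]

lemma contDiffAt_one_add_smul {u : E → ℝ} {e : E} {n : ℕ∞} (X : Matrix ι ι ℂ)
    (hu : ContDiffAt ℝ n u e) : ContDiffAt ℝ n (fun z => 1 + (u z : ℂ) • X) e :=
  contDiffAt_const.add ((Complex.ofRealCLM.contDiff.contDiffAt.comp e hu).smul contDiffAt_const)

lemma hasDerivAt_one_add_smul {u : ℝ → ℝ} {u' t : ℝ} (X : Matrix ι ι ℂ)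
    (hu : HasDerivAt u u' t) : HasDerivAt (fun z => 1 + (u z : ℂ) • X) ((u' : ℂ) • X) t :=
  (hu.ofReal_comp.smul_const X).const_add 1

variable {c s : ℝ} {p q : ι → ℝ}

lemma contDiffAt_pencil {A : E → Matrix ι ι ℂ} {u v : E → ℝ} {e : E} {n : ℕ∞}
    (hq : ∀ i, 0 ≤ q i) (hA : ContDiffAt ℝ n A e) (hu : ContDiffAt ℝ n u e)
    (hv : ContDiffAt ℝ n v e) (hu0 : 0 ≤ u e) :
    ContDiffAt ℝ n (fun z => pencil s p q (A z) (u z) (v z)) e := by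
  have h1 := contDiffAt_matrix_inv (contDiffAt_one_add_smul (realDiag q) hu)
    (posDef_one_add_smul hq hu0).isUnit
  have h2 : ContDiffAt ℝ n (fun z => (s : ℂ) • (1 + (v z : ℂ) • realDiag p)) e :=
    (contDiffAt_one_add_smul (realDiag p) hv).const_smul (s : ℂ)
  exact h2.add ((hA.mul h1).mul (contDiffAt_conjTranspose hA))

lemma contDiffAt_traceFun {A : E → Matrix ι ι ℂ} {u v : E → ℝ} {e : E} {n : ℕ∞}
    (hs : 0 < s) (hp : ∀ i, 0 ≤ p i) (hq : ∀ i, 0 ≤ q i) (hA : ContDiffAt ℝ n A e)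
    (hu : ContDiffAt ℝ n u e) (hv : ContDiffAt ℝ n v e) (hu0 : 0 ≤ u e) (hv0 : 0 ≤ v e) :
    ContDiffAt ℝ n (fun z => traceFun c s p q (A z) (u z) (v z)) e := by
  have h1 := contDiffAt_matrix_inv (contDiffAt_pencil (s := s) (p := p) hq hA hu hv hu0)
    (posDef_pencil hs hp hq hu0 hv0).isUnit
  have h2 : ContDiffAt ℝ n (fun z => realDiag p * (pencil s p q (A z) (u z) (v z))⁻¹) e :=
    contDiffAt_const.mul h1
  have h3 := Complex.reCLM.contDiff.contDiffAt.comp e (traceCLM.contDiff.contDiffAt.comp e h2)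
  exact contDiffAt_const.mul h3

lemma hasDerivAt_traceFun {A : Matrix ι ι ℂ} {x y : ℝ → ℝ} {t : ℝ} {X' : Matrix ι ι ℂ}
    (h : HasDerivAt (fun u => pencil s p q A (x u) (y u)) X' t)
    (hX : IsUnit (pencil s p q A (x t) (y t))) :
    HasDerivAt (fun u => traceFun c s p q A (x u) (y u))
      (-(c * (realDiag p * ((pencil s p q A (x t) (y t))⁻¹ * X' *
        (pencil s p q A (x t) (y t))⁻¹)).trace.re)) t := by
  have h1 := (hasDerivAt_matrix_inv h hX).const_mul (realDiag p)
  have h2 := ((Complex.reCLM.hasFDerivAt.comp_hasDerivAt t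
    (traceCLM.hasFDerivAt.comp_hasDerivAt t h1))).const_mul c
  refine h2.congr_deriv ?_
  change c * (Matrix.trace (realDiag p * -((pencil s p q A (x t) (y t))⁻¹ * X' *
    (pencil s p q A (x t) (y t))⁻¹))).re = _
  rw [mul_neg, Matrix.trace_neg, Complex.neg_re, mul_neg]

/-- The partial derivatives of the normalized trace: their signs, and the strict Euler-type
inequality behind the nondegeneracy of the fixed-point system. -/
lemma exists_partials_traceFun {A : Matrix ι ι ℂ} {x y : ℝ} (hc : 0 < c) (hs : 0 < s)
    (hp : ∀ i, 0 ≤ p i) (hp0 : ∃ i, 0 < p i) (hq : ∀ i, 0 ≤ q i) (hx : 0 ≤ x) (hy : 0 ≤ y) :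
    ∃ a b : ℝ, 0 ≤ a ∧ 0 ≤ b ∧ HasDerivAt (fun t => traceFun c s p q A t y) a x ∧
      HasDerivAt (fun t => traceFun c s p q A x t) (-b) y ∧
      x * a + y * b < traceFun c s p q A x y := by
  set R := (pencil s p q A x y)⁻¹ with hR
  set V := (1 + (x : ℂ) • realDiag q)⁻¹ with hV
  have hK := posDef_pencil (A := A) hs hp hq hx hy
  have hW := posDef_one_add_smul hq hx
  have hRh : Rᴴ = R := hK.inv.isHermitian
  have hVh : Vᴴ = V := hW.inv.isHermitian
  have psdR : ∀ Y : Matrix ι ι ℂ, Y.PosSemidef → (R * Y * R).PosSemidef := fun Y hY => by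
    simpa [hRh] using hY.mul_mul_conjTranspose_same R
  have psdV : ∀ Y : Matrix ι ι ℂ, Y.PosSemidef → (A * (V * Y * V) * Aᴴ).PosSemidef :=
    fun Y hY => by
      have := hY.mul_mul_conjTranspose_same V
      rw [hVh] at this
      exact this.mul_mul_conjTranspose_same A
  have hdx : HasDerivAt (fun t => pencil s p q A t y) (-(A * (V * realDiag q * V) * Aᴴ)) x := by
    have h1 := hasDerivAt_matrix_inv (hasDerivAt_one_add_smul (realDiag q) (hasDerivAt_id x))
      hW.isUnit
    have h2 := (((h1.const_mul A).mul_const Aᴴ).const_add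
      ((s : ℂ) • (1 + (y : ℂ) • realDiag p)))
    refine h2.congr_deriv ?_
    simp [hV]
  have hdy : HasDerivAt (fun t => pencil s p q A x t) ((s : ℂ) • realDiag p) y := by
    have h2 := ((hasDerivAt_one_add_smul (realDiag p) (hasDerivAt_id y)).const_smul
      (s : ℂ)).add_const (A * V * Aᴴ)
    refine h2.congr_deriv ?_
    simp
  have hda := hasDerivAt_traceFun (c := c) (x := fun t => t) (y := fun _ => y) hdx hK.isUnit
  have hdb := hasDerivAt_traceFun (c := c) (x := fun _ => x) (y := fun t => t) hdy hK.isUnit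
  rw [← hR] at hda hdb
  refine ⟨_, _, ?_, ?_, hda, hdb, ?_⟩
  · have := trace_realDiag_mul_nonneg hp (psdR _ (psdV _ (posSemidef_realDiag hq)))
    simp only [mul_neg, neg_mul, Matrix.trace_neg, Complex.neg_re, neg_neg]
    exact mul_nonneg hc.le this
  · exact mul_nonneg hc.le (trace_realDiag_mul_nonneg hp
      (psdR _ (posSemidef_ofReal_smul (posSemidef_realDiag hp) hs.le)))
  -- The gap in the inequality is exactly c tr(P R (sI + A V² Aᴴ) R), which is positive.
  · have hpos : (R * ((s : ℂ) • (1 : Matrix ι ι ℂ) + A * (V * 1 * V) * Aᴴ) * R).PosDef := by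
      have h1 : ((s : ℂ) • (1 : Matrix ι ι ℂ) + A * (V * 1 * V) * Aᴴ).PosDef :=
        (posDef_ofReal_smul Matrix.PosDef.one hs).add_posSemidef (psdV _ Matrix.PosSemidef.one)
      have h2 := h1.mul_mul_conjTranspose_same (B := R)
        (Matrix.vecMul_injective_of_isUnit hK.inv.isUnit)
      rwa [hRh] at h2
    have h3 := mul_pos hc (trace_realDiag_mul_pos hp hp0 hpos)
    have hVV : V = V * 1 * V + (x : ℂ) • (V * realDiag q * V) := by
      have : V * (1 + (x : ℂ) • realDiag q) * V = V := by
        rw [hV, Matrix.nonsing_inv_mul _ ((Matrix.isUnit_iff_isUnit_det _).1 hW.isUnit), one_mul]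
      conv_lhs => rw [← this]
      simp [mul_add, add_mul]
    -- Write R = R K R with K the pencil, and split V inside K by `hVV`: the x- and y-terms
    -- reproduce the two partial derivatives.
    have hRR : R = R * ((s : ℂ) • (1 : Matrix ι ι ℂ) + A * (V * 1 * V) * Aᴴ) * R +
        (x : ℂ) • (R * (A * (V * realDiag q * V) * Aᴴ) * R) +
        (y : ℂ) • (R * ((s : ℂ) • realDiag p) * R) := by
      have h4 : R * pencil s p q A x y * R = R := by
        rw [hR, Matrix.nonsing_inv_mul _ ((Matrix.isUnit_iff_isUnit_det _).1 hK.isUnit), one_mul]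
      have h5 : pencil s p q A x y = (s : ℂ) • (1 : Matrix ι ι ℂ) + A * (V * 1 * V) * Aᴴ +
          (x : ℂ) • (A * (V * realDiag q * V) * Aᴴ) + (y : ℂ) • ((s : ℂ) • realDiag p) := by
        rw [pencil, ← hV]
        conv_lhs => rw [hVV]
        simp only [mul_add, add_mul, smul_add, Matrix.mul_smul, Matrix.smul_mul,
          smul_comm (y : ℂ) (s : ℂ)]
        abel
      conv_lhs => rw [← h4, h5]
      simp only [mul_add, add_mul, Matrix.mul_smul, Matrix.smul_mul]
    have h6 : traceFun c s p q A x y = c * (realDiag p * R).trace.re := rfl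
    have h7 : (realDiag p * R).trace.re =
        (realDiag p * (R * ((s : ℂ) • (1 : Matrix ι ι ℂ) +
          A * (V * 1 * V) * Aᴴ) * R)).trace.re +
        x * (realDiag p * (R * (A * (V * realDiag q * V) * Aᴴ) * R)).trace.re +
        y * (realDiag p * (R * ((s : ℂ) • realDiag p) * R)).trace.re := by
      conv_lhs => rw [hRR]
      rw [mul_add, mul_add, Matrix.trace_add, Matrix.trace_add, Matrix.mul_smul, Matrix.mul_smul,
        Matrix.trace_smul, Matrix.trace_smul, Complex.add_re, Complex.add_re, smul_eq_mul,
        smul_eq_mul, Complex.re_ofReal_mul, Complex.re_ofReal_mul]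
    rw [h6, h7]
    simp only [mul_neg, neg_mul, Matrix.trace_neg, Complex.neg_re, neg_neg]
    linarith

end Smoothness

/-! ### Differentiable dependence of the solution on a parameter -/

section Implicit

variable {E : Type*} [NormedAddCommGroup E] [NormedSpace ℝ E] [CompleteSpace E]

/-- Differentiability in the parameter of the unique positive solution of a nondegenerate mixed
monotone system. -/
lemma differentiableAt_fixedPoint {f g : E → ℝ → ℝ → ℝ} {ψ : E → ℝ × ℝ} {e : E}
    {x y a b a' b' : ℝ} (hx : 0 < x) (hy : 0 < y)
    (hf : ContDiffAt ℝ 1 (fun z : E × (ℝ × ℝ) => f z.1 z.2.1 z.2.2) (e, (x, y)))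
    (hg : ContDiffAt ℝ 1 (fun z : E × (ℝ × ℝ) => g z.1 z.2.2 z.2.1) (e, (x, y)))
    (hfx : x = f e x y) (hgy : y = g e y x)
    (hψ : ∀ e x y, 0 < x → 0 < y → x = f e x y → y = g e y x → ψ e = (x, y))
    (hb : 0 ≤ b) (hb' : 0 ≤ b')
    (hfa : HasDerivAt (fun t => f e t y) a x) (hfb : HasDerivAt (fun t => f e x t) (-b) y)
    (hga : HasDerivAt (fun t => g e t x) a' y) (hgb : HasDerivAt (fun t => g e y t) (-b') x)
    (hab : x * a + y * b < x) (hab' : y * a' + x * b' < y) :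
    DifferentiableAt ℝ ψ e := by
  let Ψ : E × (ℝ × ℝ) → ℝ × ℝ := fun z => (z.2.1 - f z.1 z.2.1 z.2.2, z.2.2 - g z.1 z.2.2 z.2.1)
  have hΨ : ContDiffAt ℝ 1 Ψ (e, (x, y)) :=
    ((contDiff_fst.comp contDiff_snd).contDiffAt.sub hf).prodMk
      ((contDiff_snd.comp contDiff_snd).contDiffAt.sub hg)
  have hstr := hΨ.hasStrictFDerivAt (by simp)
  set L := fderiv ℝ Ψ (e, (x, y)) with hL
  have hL1 : L (0, (1, 0)) = (1 - a, b') := by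
    have h1 : HasDerivAt (fun t : ℝ => ((e, (t, y)) : E × (ℝ × ℝ))) (0, (1, 0)) x :=
      (hasDerivAt_const x e).prodMk ((hasDerivAt_id x).prodMk (hasDerivAt_const x y))
    have h2 := hstr.hasFDerivAt.comp_hasDerivAt x h1
    have h3 : HasDerivAt (fun t : ℝ => Ψ (e, (t, y))) (1 - a, b') x := by
      have := ((hasDerivAt_id x).sub hfa).prodMk (hgb.const_sub y)
      rw [neg_neg] at this
      exact this
    exact h2.unique h3
  have hL2 : L (0, (0, 1)) = (b, 1 - a') := by
    have h1 : HasDerivAt (fun t : ℝ => ((e, (x, t)) : E × (ℝ × ℝ))) (0, (0, 1)) y :=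
      (hasDerivAt_const y e).prodMk ((hasDerivAt_const y x).prodMk (hasDerivAt_id y))
    have h2 := hstr.hasFDerivAt.comp_hasDerivAt y h1
    have h3 : HasDerivAt (fun t : ℝ => Ψ (e, (x, t))) (b, 1 - a') y := by
      have := (hfb.const_sub x).prodMk ((hasDerivAt_id y).sub hga)
      rw [neg_neg] at this
      exact this
    exact h2.unique h3
  have hinj : Function.Injective (L ∘L .inr ℝ E (ℝ × ℝ)) := by
    refine (injective_iff_map_eq_zero _).2 ?_
    rintro ⟨ξ, η⟩ h0
    have h1 : (L ∘L .inr ℝ E (ℝ × ℝ)) (ξ, η) = ξ • L (0, (1, 0)) + η • L (0, (0, 1)) := by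
      rw [← map_smul, ← map_smul, ← map_add]
      simp
    rw [h1, hL1, hL2] at h0
    have e1 : ξ * (1 - a) + η * b = 0 := congrArg Prod.fst h0
    have e2 : ξ * b' + η * (1 - a') = 0 := congrArg Prod.snd h0
    have k1 : y * b < x * (1 - a) := by linarith
    have k2 : x * b' < y * (1 - a') := by linarith
    -- Multiplying the two dominance inequalities gives xy·bb' < xy·(1 - a)(1 - a'), so the Jacobian
    -- determinant is positive.
    have k3 := mul_lt_mul'' k1 k2 (by positivity) (by positivity)
    have hdet : 0 < (1 - a) * (1 - a') - b * b' := by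
      have : 0 < (x * y) * ((1 - a) * (1 - a') - b * b') := by linarith
      exact pos_of_mul_pos_right this (by positivity)
    have z1 : ξ * ((1 - a) * (1 - a') - b * b') = 0 := by
      linear_combination (1 - a') * e1 - b * e2
    have z2 : η * ((1 - a) * (1 - a') - b * b') = 0 := by
      linear_combination (1 - a) * e2 - b' * e1
    exact Prod.ext ((mul_eq_zero.1 z1).resolve_right hdet.ne')
      ((mul_eq_zero.1 z2).resolve_right hdet.ne')
  have hinv : (L ∘L .inr ℝ E (ℝ × ℝ)).IsInvertible :=
    ⟨(LinearEquiv.ofInjectiveEndo (L ∘L .inr ℝ E (ℝ × ℝ)).toLinearMap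
      hinj).toContinuousLinearEquiv, by ext <;> rfl⟩
  have hΨ0 : Ψ (e, (x, y)) = 0 :=
    Prod.ext (sub_eq_zero.2 hfx) (sub_eq_zero.2 hgy)
  have hd := (hstr.hasStrictFDerivAt_implicitFunctionOfProdDomain hinv).hasFDerivAt
  have ht := hstr.tendsto_implicitFunctionOfProdDomain hinv
  have hev := hstr.eventually_apply_implicitFunctionOfProdDomain hinv
  set χ := hstr.implicitFunctionOfProdDomain hinv
  -- The implicit branch is continuous at e, hence stays positive nearby, and `hψ` then forces it to
  -- equal ψ. No continuity of ψ is needed.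
  have heq : ψ =ᶠ[𝓝 e] χ := by
    have p1 : ∀ᶠ z in 𝓝 e, 0 < (χ z).1 :=
      ((continuous_fst.tendsto (x, y)).comp ht).eventually_const_lt hx
    have p2 : ∀ᶠ z in 𝓝 e, 0 < (χ z).2 :=
      ((continuous_snd.tendsto (x, y)).comp ht).eventually_const_lt hy
    filter_upwards [p1, p2, hev] with z h1 h2 h3
    rw [hΨ0] at h3
    exact hψ z _ _ h1 h2 (sub_eq_zero.1 (congrArg Prod.fst h3))
      (sub_eq_zero.1 (congrArg Prod.snd h3))
  exact (hd.congr_of_eventuallyEq heq).differentiableAt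

end Implicit

attribute [local instance] Matrix.linftyOpNormedRing Matrix.linftyOpNormedAlgebra

/-- The determinant is real and positive at t, so it cancels from the real part of Jacobi's formula.
-/
lemma hasDerivAt_log_det_re {ι : Type*} [Fintype ι] [DecidableEq ι] {X : ℝ → Matrix ι ι ℂ}
    {X' : Matrix ι ι ℂ} {t : ℝ} (h : HasDerivAt X X' t) (hX : (X t).PosDef) :
    HasDerivAt (fun u => Real.log (X u).det.re) ((X t)⁻¹ * X').trace.re t := by
  obtain ⟨h1, h2⟩ := Complex.lt_def.1 hX.det_pos
  have h3 := Complex.reCLM.hasFDerivAt.comp_hasDerivAt t (hasDerivAt_det h hX.isUnit)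
  have h4 : HasDerivAt (fun u => (X u).det.re) ((X t).det * ((X t)⁻¹ * X').trace).re t := h3
  have h5 := h4.log h1.ne'
  have h6 : (X t).det.im = 0 := h2.symm
  rw [Complex.mul_re, h6, zero_mul, sub_zero, mul_div_cancel_left₀ _ h1.ne'] at h5
  exact h5

lemma ofReal_eq_mul_iff {x c : ℝ} {z : ℂ} (hz : z.im = 0) :
    (x : ℂ) = (c : ℂ) * z ↔ x = c * z.re := by
  constructor
  · intro h
    simpa using congrArg Complex.re h
  · intro h
    refine Complex.ext ?_ ?_ <;> simp [h, hz]

/-! ### The eavesdropping system as an instance of the trace system -/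

namespace System

variable {N M : ℕ} {S : System N M}

/-- The standing assumptions on the data of the system. -/
structure Admissible (S : System N M) : Prop where
  sigma_pos : 0 < S.σ
  beta_pos : ∀ m, 0 < S.β m
  K_nonneg : ∀ m, 0 ≤ S.K m
  F_ne_zero : S.F ≠ 0

variable (S) in
/-- The diagonal of `D`. -/
def diagD (m : Fin M) : ℝ := (M : ℝ) * S.β m / (S.K m + 1)

variable (S) in
/-- The diagonal of `D̃`. -/
def diagDt (k : Fin M) : ℝ := ∑ n, ‖S.F n k‖ ^ 2

lemma realDiag_diagD : realDiag S.diagD = S.D := rfl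

lemma realDiag_diagDt : realDiag S.diagDt = S.Dt := rfl

namespace Admissible

lemma exists_entry_ne_zero (h : S.Admissible) : ∃ n m, S.F n m ≠ 0 := by
  by_contra! hc
  exact h.F_ne_zero (Matrix.ext hc)

lemma M_pos (h : S.Admissible) : 0 < M :=
  let ⟨_, m, _⟩ := h.exists_entry_ne_zero
  m.pos

lemma scale_pos (h : S.Admissible) : (0 : ℝ) < 1 / (M : ℝ) :=
  one_div_pos.2 (by exact_mod_cast h.M_pos)

lemma noise_pos (h : S.Admissible) : 0 < S.σ ^ 2 := pow_pos h.sigma_pos 2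

lemma diagD_pos (h : S.Admissible) (m : Fin M) : 0 < S.diagD m := by
  have h1 : (0 : ℝ) < M := by exact_mod_cast h.M_pos
  have h2 := h.beta_pos m
  have h3 := h.K_nonneg m
  unfold diagD
  positivity

lemma diagD_nonneg (h : S.Admissible) (m : Fin M) : 0 ≤ S.diagD m := (h.diagD_pos m).le

lemma exists_diagD_pos (h : S.Admissible) : ∃ m, 0 < S.diagD m :=
  ⟨⟨0, h.M_pos⟩, h.diagD_pos _⟩

lemma diagDt_nonneg (_ : S.Admissible) (k : Fin M) : 0 ≤ S.diagDt k :=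
  Finset.sum_nonneg fun _ _ => sq_nonneg _

lemma exists_diagDt_pos (h : S.Admissible) : ∃ k, 0 < S.diagDt k := by
  obtain ⟨n, m, hnm⟩ := h.exists_entry_ne_zero
  exact ⟨m, Finset.sum_pos' (fun _ _ => sq_nonneg _)
    ⟨n, Finset.mem_univ n, pow_pos (norm_pos_iff.2 hnm) 2⟩⟩

lemma posDef_one_add_D (h : S.Admissible) {y : ℝ} (hy : 0 ≤ y) :
    (1 + (y : ℂ) • S.D).PosDef := posDef_one_add_smul h.diagD_nonneg hy

lemma posDef_one_add_Dt (h : S.Admissible) {x : ℝ} (hx : 0 ≤ x) :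
    (1 + (x : ℂ) • S.Dt).PosDef := posDef_one_add_smul h.diagDt_nonneg hx

lemma inv_PhiOf (h : S.Admissible) {y : ℝ} (hy : 0 ≤ y) :
    (S.PhiOf y)⁻¹ = 1 + (y : ℂ) • S.D :=
  Matrix.nonsing_inv_nonsing_inv _
    ((Matrix.isUnit_iff_isUnit_det _).1 (h.posDef_one_add_D hy).isUnit)

lemma inv_PhitOf (h : S.Admissible) {x : ℝ} (hx : 0 ≤ x) :
    (S.PhitOf x)⁻¹ = 1 + (x : ℂ) • S.Dt :=
  Matrix.nonsing_inv_nonsing_inv _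
    ((Matrix.isUnit_iff_isUnit_det _).1 (h.posDef_one_add_Dt hx).isUnit)

lemma GamOf_eq (h : S.Admissible) (T : Positions N) {x y : ℝ} (hy : 0 ≤ y) :
    S.GamOf T x y = (pencil (S.σ ^ 2) S.diagD S.diagDt (S.B T) x y)⁻¹ := by
  rw [GamOf, h.inv_PhiOf hy, pencil, Complex.ofReal_pow]
  rfl

/-- The duality: this is the pencil of Γ with D and D̃, B and Bᴴ, x and y exchanged. -/
lemma GamtOf_eq (h : S.Admissible) (T : Positions N) {x y : ℝ} (hx : 0 ≤ x) :
    S.GamtOf T x y = (pencil (S.σ ^ 2) S.diagDt S.diagD (S.B T)ᴴ y x)⁻¹ := by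
  rw [GamtOf, h.inv_PhitOf hx, pencil, Complex.ofReal_pow, Matrix.conjTranspose_conjTranspose]
  rfl

lemma posDef_GamOf (h : S.Admissible) (T : Positions N) {x y : ℝ} (hx : 0 ≤ x) (hy : 0 ≤ y) :
    (S.GamOf T x y).PosDef := by
  rw [h.GamOf_eq T hy]
  exact (posDef_pencil h.noise_pos h.diagD_nonneg h.diagDt_nonneg hx hy).inv

lemma posDef_GamtOf (h : S.Admissible) (T : Positions N) {x y : ℝ} (hx : 0 ≤ x) (hy : 0 ≤ y) :
    (S.GamtOf T x y).PosDef := by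
  rw [h.GamtOf_eq T hx]
  exact (posDef_pencil h.noise_pos h.diagDt_nonneg h.diagD_nonneg hy hx).inv

/-- Both traces are of products of Hermitian matrices, hence real, so the complex equations lose
nothing when reduced to real parts. -/
lemma isPositiveSolution_iff (h : S.Admissible) (T : Positions N) (z : ℝ × ℝ) :
    S.IsPositiveSolution T z ↔ 0 < z.1 ∧ 0 < z.2 ∧
      z.1 = traceFun (1 / M) (S.σ ^ 2) S.diagD S.diagDt (S.B T) z.1 z.2 ∧
      z.2 = traceFun (1 / M) (S.σ ^ 2) S.diagDt S.diagD (S.B T)ᴴ z.2 z.1 := by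
  unfold IsPositiveSolution
  refine and_congr_right fun h1 => and_congr_right fun h2 => ?_
  have e : (1 / (M : ℂ)) = ((1 / (M : ℝ) : ℝ) : ℂ) := by push_cast; rfl
  rw [traceFun, traceFun, ← h.GamOf_eq T h2.le, ← h.GamtOf_eq T h1.le, e,
    ofReal_eq_mul_iff, ofReal_eq_mul_iff, realDiag_diagD, realDiag_diagDt]
  · exact trace_mul_im_eq_zero (posSemidef_realDiag h.diagDt_nonneg).isHermitian
      (h.posDef_GamtOf T h1.le h2.le).isHermitian
  · exact trace_mul_im_eq_zero (posSemidef_realDiag h.diagD_nonneg).isHermitian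
      (h.posDef_GamOf T h1.le h2.le).isHermitian

lemma existsUnique_isPositiveSolution (h : S.Admissible) (T : Positions N) :
    ∃! z : ℝ × ℝ, S.IsPositiveSolution T z := by
  simp only [h.isPositiveSolution_iff]
  exact existsUnique_traceFun_fixedPoint (S.B T) h.scale_pos h.noise_pos h.diagD_nonneg
    h.exists_diagD_pos h.diagDt_nonneg h.exists_diagDt_pos

lemma isPositiveSolution_fixedPoint (h : S.Admissible) (T : Positions N) :
    S.IsPositiveSolution T (S.fixedPoint T) :=
  Classical.epsilon_spec (h.existsUnique_isPositiveSolution T).exists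

lemma delta_pos (h : S.Admissible) (T : Positions N) : 0 < S.delta T :=
  (h.isPositiveSolution_fixedPoint T).1

lemma deltat_pos (h : S.Admissible) (T : Positions N) : 0 < S.deltat T :=
  (h.isPositiveSolution_fixedPoint T).2.1

end Admissible

/-! ### Dependence of the channel on the positions -/

lemma B_apply (T : Positions N) (a b : Fin M) :
    S.B T a b = ∑ n, ((Real.sqrt (S.K a * S.β a / (S.K a + 1)) : ℝ) : ℂ) *
      (S.GLoS T)ᴴ a n * S.F n b := by
  simp [B, sqrtLambda, Matrix.mul_apply, Matrix.diagonal_apply]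

lemma conjTranspose_GLoS_apply (T : Positions N) (m : Fin M) (n : Fin N) :
    (S.GLoS T)ᴴ m n = Complex.exp
      (-Complex.I * ((2 * Real.pi / S.lam * ∑ i, T n i * S.rho m i : ℝ) : ℂ)) := by
  simp only [GLoS, Matrix.conjTranspose_apply, Matrix.of_apply, Complex.star_def,
    ← Complex.exp_conj, map_mul, Complex.conj_I, Complex.conj_ofReal]

lemma contDiff_coord (n : Fin N) (i : Fin 2) :
    ContDiff ℝ 1 (fun T : Positions N => T n i) := by
  fun_prop

lemma contDiff_conjTranspose_GLoS (m : Fin M) (n : Fin N) :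
    ContDiff ℝ 1 (fun T : Positions N => (S.GLoS T)ᴴ m n) := by
  simp only [conjTranspose_GLoS_apply]
  refine Complex.contDiff_exp.comp (contDiff_const.mul (Complex.ofRealCLM.contDiff.comp ?_))
  exact contDiff_const.mul (ContDiff.sum fun i _ => (contDiff_coord n i).mul contDiff_const)

lemma contDiff_B : ContDiff ℝ 1 (S.B : Positions N → Matrix (Fin M) (Fin M) ℂ) := by
  refine contDiff_iff_contDiffAt.2 fun T => contDiffAt_matrix (n := 1) fun a b => ?_
  simp only [B_apply]
  exact ContDiffAt.sum fun n _ =>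
    (contDiffAt_const.mul (contDiff_conjTranspose_GLoS a n).contDiffAt).mul contDiffAt_const

/-- Moving antenna n changes only the n-th column of the conjugate transpose, so the derivative is a
rank-one matrix supported on that column. -/
lemma hasDerivAt_conjTranspose_GLoS (T : Positions N) (n : Fin N) (i : Fin 2) (m : Fin M)
    (n' : Fin N) :
    HasDerivAt (fun t : ℝ => (S.GLoS (T + t • coordDir n i))ᴴ m n')
      (Matrix.vecMulVec (S.gtDeriv T n i) (Pi.single n (1 : ℂ)) m n') 0 := by
  simp only [conjTranspose_GLoS_apply]
  have h1 : HasDerivAt (fun t : ℝ => 2 * Real.pi / S.lam *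
      ∑ k, (T + t • coordDir n i) n' k * S.rho m k)
      (2 * Real.pi / S.lam * ∑ k, coordDir n i n' k * S.rho m k) 0 := by
    refine HasDerivAt.const_mul _ (HasDerivAt.fun_sum fun k _ => HasDerivAt.mul_const ?_ _)
    simpa using ((hasDerivAt_id (0 : ℝ)).mul_const (coordDir n i n' k)).const_add (T n' k)
  have h2 := (h1.ofReal_comp.const_mul (-Complex.I)).cexp
  refine h2.congr_deriv ?_
  rw [zero_smul, add_zero, Matrix.vecMulVec_apply, gtDeriv]
  by_cases hn : n' = n
  · subst hn
    have : ∑ k, coordDir n' i n' k * S.rho m k = S.rho m i := by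
      simp [coordDir]
    rw [this]
    simp only [Pi.single_eq_same, mul_one]
    ring
  · simp [coordDir, hn]

lemma hasDerivAt_B (T : Positions N) (n : Fin N) (i : Fin 2) :
    HasDerivAt (fun t : ℝ => S.B (T + t • coordDir n i))
      (S.sqrtLambda * Matrix.vecMulVec (S.gtDeriv T n i) (Pi.single n (1 : ℂ)) * S.F) 0 := by
  refine hasDerivAt_matrix_iff.2 fun a b => ?_
  have e : (S.sqrtLambda * Matrix.vecMulVec (S.gtDeriv T n i) (Pi.single n (1 : ℂ)) * S.F) a b =
      ∑ n', ((Real.sqrt (S.K a * S.β a / (S.K a + 1)) : ℝ) : ℂ) *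
        Matrix.vecMulVec (S.gtDeriv T n i) (Pi.single n (1 : ℂ)) a n' * S.F n' b := by
    rw [Matrix.mul_apply]
    simp only [sqrtLambda, Matrix.diagonal_mul]
  rw [e]
  simp only [B_apply]
  exact HasDerivAt.fun_sum fun n' _ =>
    ((hasDerivAt_conjTranspose_GLoS T n i a n').const_mul _).mul_const _

namespace Admissible

lemma contDiffAt_traceFun_B (h : S.Admissible) {T : Positions N} {x y : ℝ} (hx : 0 ≤ x)
    (hy : 0 ≤ y) : ContDiffAt ℝ 1 (fun z : Positions N × (ℝ × ℝ) =>
      traceFun (1 / M) (S.σ ^ 2) S.diagD S.diagDt (S.B z.1) z.2.1 z.2.2) (T, (x, y)) :=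
  contDiffAt_traceFun (n := 1) h.noise_pos h.diagD_nonneg h.diagDt_nonneg
    (contDiff_B.contDiffAt.comp _ contDiffAt_fst)
    (contDiffAt_fst.comp _ contDiffAt_snd) (contDiffAt_snd.comp _ contDiffAt_snd) hx hy

lemma contDiffAt_traceFun_conjTranspose_B (h : S.Admissible) {T : Positions N} {x y : ℝ}
    (hx : 0 ≤ x) (hy : 0 ≤ y) : ContDiffAt ℝ 1 (fun z : Positions N × (ℝ × ℝ) =>
      traceFun (1 / M) (S.σ ^ 2) S.diagDt S.diagD (S.B z.1)ᴴ z.2.2 z.2.1) (T, (x, y)) :=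
  contDiffAt_traceFun (n := 1) h.noise_pos h.diagDt_nonneg h.diagD_nonneg
    (contDiffAt_conjTranspose (n := 1) (contDiff_B.contDiffAt.comp _ contDiffAt_fst))
    (contDiffAt_snd.comp _ contDiffAt_snd) (contDiffAt_fst.comp _ contDiffAt_snd) hy hx

lemma differentiableAt_fixedPoint (h : S.Admissible) (T : Positions N) :
    DifferentiableAt ℝ S.fixedPoint T := by
  have hx := h.delta_pos T
  have hy := h.deltat_pos T
  obtain ⟨-, -, h1, h2⟩ := (h.isPositiveSolution_iff T _).1 (h.isPositiveSolution_fixedPoint T)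
  obtain ⟨a, b, -, hb, hfa, hfb, hab⟩ := exists_partials_traceFun (A := S.B T) h.scale_pos
    h.noise_pos h.diagD_nonneg h.exists_diagD_pos h.diagDt_nonneg hx.le hy.le
  obtain ⟨a', b', -, hb', hga, hgb, hab'⟩ := exists_partials_traceFun (A := (S.B T)ᴴ) h.scale_pos
    h.noise_pos h.diagDt_nonneg h.exists_diagDt_pos h.diagD_nonneg hy.le hx.le
  refine MIMOME.differentiableAt_fixedPoint
    (f := fun T x y => traceFun (1 / M) (S.σ ^ 2) S.diagD S.diagDt (S.B T) x y)
    (g := fun T y x => traceFun (1 / M) (S.σ ^ 2) S.diagDt S.diagD (S.B T)ᴴ y x)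
    hx hy (h.contDiffAt_traceFun_B hx.le hy.le)
    (h.contDiffAt_traceFun_conjTranspose_B hx.le hy.le) h1 h2 ?_ hb hb' hfa hfb hga hgb
    (hab.trans_eq h1.symm) (hab'.trans_eq h2.symm)
  intro T' x y hx hy e1 e2
  exact (h.existsUnique_isPositiveSolution T').unique (h.isPositiveSolution_fixedPoint T')
    ((h.isPositiveSolution_iff T' (x, y)).2 ⟨hx, hy, e1, e2⟩)

end Admissible

end System

lemma hasMatrixPartial_of_hasDerivAt {N M : ℕ} {A : Positions N → Matrix (Fin M) (Fin M) ℂ}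
    {A' : Matrix (Fin M) (Fin M) ℂ} {T : Positions N} {n : Fin N} {i : Fin 2}
    (h : HasDerivAt (fun t : ℝ => A (T + t • coordDir n i)) A' 0) : HasMatrixPartial A A' T n i :=
  fun a b => hasDerivAt_matrix_iff.1 h a b

/-- The derivative of a curve of Hermitian matrices is Hermitian. -/
lemma isHermitian_of_hasDerivAt {ι : Type*} [Fintype ι] [DecidableEq ι] {X : ℝ → Matrix ι ι ℂ}
    {X' : Matrix ι ι ℂ} {t : ℝ} (h : HasDerivAt X X' t) (hX : ∀ u, (X u).IsHermitian) :
    X'.IsHermitian := by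
  have h1 := hasDerivAt_conjTranspose h
  simp only [fun u => (hX u).eq] at h1
  exact h1.unique h

lemma update_add_smul_single {N : ℕ} (T : Positions N) (n : Fin N) (i : Fin 2) (t : ℝ) :
    Function.update T n (T n + t • EuclideanSpace.single i (1 : ℝ)) = T + t • coordDir n i := by
  ext n' k
  by_cases hn : n' = n
  · subst hn; simp [coordDir]
  · simp [coordDir, hn]

/-! ### The differentiated system and the gradient of the rate -/

namespace System

variable {N M : ℕ} {S : System N M}

namespace Admissible

lemma Gam_eq (h : S.Admissible) (T : Positions N) :
    S.Gam T = (((S.σ : ℂ) ^ 2) • (1 + (S.deltat T : ℂ) • S.D) + S.Xi T)⁻¹ := by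
  rw [Gam, GamOf, h.inv_PhiOf (h.deltat_pos T).le]; rfl

lemma Gamt_eq (h : S.Admissible) (T : Positions N) :
    S.Gamt T = (((S.σ : ℂ) ^ 2) • (1 + (S.delta T : ℂ) • S.Dt) + S.Xit T)⁻¹ := by
  rw [Gamt, GamtOf, h.inv_PhitOf (h.delta_pos T).le]; rfl

lemma posDef_Gam (h : S.Admissible) (T : Positions N) : (S.Gam T).PosDef :=
  h.posDef_GamOf T (h.delta_pos T).le (h.deltat_pos T).le

lemma posDef_Gamt (h : S.Admissible) (T : Positions N) : (S.Gamt T).PosDef :=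
  h.posDef_GamtOf T (h.delta_pos T).le (h.deltat_pos T).le

lemma posDef_Phi (h : S.Admissible) (T : Positions N) : (S.Phi T).PosDef :=
  (h.posDef_one_add_D (h.deltat_pos T).le).inv

lemma posDef_Phit (h : S.Admissible) (T : Positions N) : (S.Phit T).PosDef :=
  (h.posDef_one_add_Dt (h.delta_pos T).le).inv

lemma isUnit_inv_Gam (h : S.Admissible) (T : Positions N) :
    IsUnit (((S.σ : ℂ) ^ 2) • (1 + (S.deltat T : ℂ) • S.D) + S.Xi T) := by
  have := (h.posDef_Gam T).isUnit
  rw [h.Gam_eq T] at this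
  exact Matrix.isUnit_nonsing_inv_iff.1 this

lemma isUnit_inv_Gamt (h : S.Admissible) (T : Positions N) :
    IsUnit (((S.σ : ℂ) ^ 2) • (1 + (S.delta T : ℂ) • S.Dt) + S.Xit T) := by
  have := (h.posDef_Gamt T).isUnit
  rw [h.Gamt_eq T] at this
  exact Matrix.isUnit_nonsing_inv_iff.1 this

/-- Line derivatives alone would not give a gradient. The rate is a C¹ function of the positions and
(x, y), composed with the differentiable map T ↦ (T, `fixedPoint` T). -/
lemma differentiableAt_rate (h : S.Admissible) (T : Positions N) :
    DifferentiableAt ℝ S.rate T := by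
  have hx := h.delta_pos T
  have hy := h.deltat_pos T
  let K : Positions N × (ℝ × ℝ) → Matrix (Fin M) (Fin M) ℂ := fun z =>
    pencil (S.σ ^ 2) S.diagD S.diagDt (S.B z.1) z.2.1 z.2.2
  let H : Positions N × (ℝ × ℝ) → ℝ := fun z =>
    -Real.log ((S.σ : ℂ) ^ 2 • (K z)⁻¹).det.re + Real.log (1 + (z.2.1 : ℂ) • S.Dt).det.re
      - S.σ ^ 2 * M * z.2.1 * z.2.2
  have hrate : S.rate = fun T => H (T, S.fixedPoint T) := by
    funext T'
    simp only [rate, Gam, h.GamOf_eq T' (h.deltat_pos T').le]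
    rfl
  have h1 : ContDiffAt ℝ 1 (fun z : Positions N × (ℝ × ℝ) => z.2.1) (T, S.fixedPoint T) :=
    contDiffAt_fst.comp _ contDiffAt_snd
  have h2 : ContDiffAt ℝ 1 (fun z : Positions N × (ℝ × ℝ) => z.2.2) (T, S.fixedPoint T) :=
    contDiffAt_snd.comp _ contDiffAt_snd
  have hK : ContDiffAt ℝ 1 K (T, S.fixedPoint T) :=
    contDiffAt_pencil (n := 1) h.diagDt_nonneg (contDiff_B.contDiffAt.comp _ contDiffAt_fst)
      h1 h2 hx.le
  have hKpos : (K (T, S.fixedPoint T)).PosDef :=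
    posDef_pencil h.noise_pos h.diagD_nonneg h.diagDt_nonneg hx.le hy.le
  have hG : ContDiffAt ℝ 1 (fun z => ((S.σ : ℂ) ^ 2) • (K z)⁻¹) (T, S.fixedPoint T) :=
    (contDiffAt_matrix_inv (n := 1) hK hKpos.isUnit).const_smul ((S.σ : ℂ) ^ 2)
  have hGpos : (((S.σ : ℂ) ^ 2) • (K (T, S.fixedPoint T))⁻¹).PosDef := by
    have := posDef_ofReal_smul hKpos.inv h.noise_pos
    rwa [Complex.ofReal_pow] at this
  have hDt : ContDiffAt ℝ 1 (fun z : Positions N × (ℝ × ℝ) => 1 + (z.2.1 : ℂ) • S.Dt)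
      (T, S.fixedPoint T) := contDiffAt_one_add_smul (n := 1) S.Dt h1
  have hlog : ∀ X : Positions N × (ℝ × ℝ) → Matrix (Fin M) (Fin M) ℂ,
      ContDiffAt ℝ 1 X (T, S.fixedPoint T) → (X (T, S.fixedPoint T)).PosDef →
      ContDiffAt ℝ 1 (fun z => Real.log (X z).det.re) (T, S.fixedPoint T) := fun X hX hXp =>
    (Complex.reCLM.contDiff.contDiffAt.comp _ (contDiffAt_det (n := 1) hX)).log
      (Complex.lt_def.1 hXp.det_pos).1.ne'
  have hH : ContDiffAt ℝ 1 H (T, S.fixedPoint T) :=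
    ((hlog _ hG hGpos).neg.add (hlog _ hDt (h.posDef_one_add_Dt hx.le))).sub
      ((contDiffAt_const.mul h1).mul h2)
  have hHd : DifferentiableAt ℝ H (T, S.fixedPoint T) := hH.differentiableAt (by simp)
  rw [hrate]
  exact hHd.comp T (differentiableAt_id.prodMk (h.differentiableAt_fixedPoint T))

/-- All the partial derivatives at once, together with the differentiated system. -/
lemma exists_partials (h : S.Admissible) (T : Positions N) (n : Fin N) (i : Fin 2) :
    ∃ (dδ dδt : ℝ) (dGam dGamt dPhi dPhit dXi dXit : Matrix (Fin M) (Fin M) ℂ),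
      (HasLineDerivAt ℝ S.delta dδ T (coordDir n i) ∧
        HasLineDerivAt ℝ S.deltat dδt T (coordDir n i) ∧
        HasMatrixPartial S.Gam dGam T n i ∧ HasMatrixPartial S.Gamt dGamt T n i ∧
        HasMatrixPartial S.Phi dPhi T n i ∧ HasMatrixPartial S.Phit dPhit T n i ∧
        HasMatrixPartial S.Xi dXi T n i ∧ HasMatrixPartial S.Xit dXit T n i ∧
        ∀ m, HasLineDerivAt ℝ (fun T' => (S.GLoS T').conjTranspose m n)
            (S.gtDeriv T n i m) T (coordDir n i)) ∧
      ((dδ : ℂ) = 1 / (M : ℂ) * (S.D * dGam).trace ∧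
        (dδt : ℂ) = 1 / (M : ℂ) * (S.Dt * dGamt).trace ∧
        dGam = -(S.Gam T * (((S.σ : ℂ) ^ 2 * (dδt : ℂ)) • S.D + dXi) * S.Gam T) ∧
        dGamt = -(S.Gamt T * (((S.σ : ℂ) ^ 2 * (dδ : ℂ)) • S.Dt + dXit) * S.Gamt T) ∧
        dPhi = -(S.Phi T * ((dδt : ℂ) • S.D) * S.Phi T) ∧
        dPhit = -(S.Phit T * ((dδ : ℂ) • S.Dt) * S.Phit T) ∧
        dXi = S.B T * dPhit * (S.B T).conjTranspose
          + twoRe (S.sqrtLambda *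
              Matrix.vecMulVec (S.gtDeriv T n i) (Pi.single n (1 : ℂ)) *
              S.F * S.Phit T * (S.B T).conjTranspose) ∧
        dXit = (S.B T).conjTranspose * dPhi * S.B T
          + twoRe ((S.B T).conjTranspose * S.Phi T * S.sqrtLambda *
              Matrix.vecMulVec (S.gtDeriv T n i) (Pi.single n (1 : ℂ)) * S.F)) ∧
      ∃ r : ℝ, HasDerivAt (fun t : ℝ => S.rate (T + t • coordDir n i)) r 0 ∧
        (r : ℂ) = -((S.Gam T)⁻¹ * dGam).trace + (dδ : ℂ) * (S.Phit T * S.Dt).trace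
          - (S.σ : ℂ) ^ 2 * (M : ℂ) *
              ((dδ : ℂ) * (S.deltat T : ℂ) + (S.delta T : ℂ) * (dδt : ℂ)) := by
  have hT0 : T + (0 : ℝ) • coordDir n i = T := by simp
  have hline := ((h.differentiableAt_fixedPoint T).hasFDerivAt.hasLineDerivAt (coordDir n i))
  set d := fderiv ℝ S.fixedPoint T (coordDir n i) with hd
  have hδ : HasDerivAt (fun t : ℝ => S.delta (T + t • coordDir n i)) d.1 0 :=
    (ContinuousLinearMap.fst ℝ ℝ ℝ).hasFDerivAt.comp_hasDerivAt (0 : ℝ) hline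
  have hδt : HasDerivAt (fun t : ℝ => S.deltat (T + t • coordDir n i)) d.2 0 :=
    (ContinuousLinearMap.snd ℝ ℝ ℝ).hasFDerivAt.comp_hasDerivAt (0 : ℝ) hline
  have hB := hasDerivAt_B (S := S) T n i
  set B' := S.sqrtLambda * Matrix.vecMulVec (S.gtDeriv T n i) (Pi.single n (1 : ℂ)) * S.F with hB'
  have hBh := hasDerivAt_conjTranspose hB
  have hUD := hasDerivAt_one_add_smul S.D hδt
  have hUDt := hasDerivAt_one_add_smul S.Dt hδ
  have hPhi := hasDerivAt_matrix_inv hUD (h.posDef_one_add_D (h.deltat_pos _).le).isUnit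
  have hPhit := hasDerivAt_matrix_inv hUDt (h.posDef_one_add_Dt (h.delta_pos _).le).isUnit
  rw [hT0] at hPhi hPhit
  set dPhi := -(S.Phi T * ((d.2 : ℂ) • S.D) * S.Phi T) with hdPhi
  set dPhit := -(S.Phit T * ((d.1 : ℂ) • S.Dt) * S.Phit T) with hdPhit
  replace hPhi : HasDerivAt (fun t : ℝ => S.Phi (T + t • coordDir n i)) dPhi 0 := hPhi
  replace hPhit : HasDerivAt (fun t : ℝ => S.Phit (T + t • coordDir n i)) dPhit 0 := hPhit
  set dXi := S.B T * dPhit * (S.B T)ᴴ + twoRe (B' * S.Phit T * (S.B T)ᴴ) with hdXi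
  set dXit := (S.B T)ᴴ * dPhi * S.B T + twoRe ((S.B T)ᴴ * S.Phi T * B') with hdXit
  -- Since Φ̃ is Hermitian, the two terms that differentiate B and Bᴴ are conjugate transposes of
  -- each other, whence `twoRe`.
  have hXi : HasDerivAt (fun t : ℝ => S.Xi (T + t • coordDir n i)) dXi 0 := by
    refine ((hB.mul hPhit).mul hBh).congr_deriv ?_
    simp only [hT0, Pi.mul_apply, hdXi, twoRe, Matrix.conjTranspose_mul,
      Matrix.conjTranspose_conjTranspose, (h.posDef_Phit T).isHermitian.eq, add_mul, mul_assoc]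
    abel
  have hXit : HasDerivAt (fun t : ℝ => S.Xit (T + t • coordDir n i)) dXit 0 := by
    refine ((hBh.mul hPhi).mul hB).congr_deriv ?_
    simp only [hT0, Pi.mul_apply, hdXit, twoRe, Matrix.conjTranspose_mul,
      Matrix.conjTranspose_conjTranspose, (h.posDef_Phi T).isHermitian.eq, add_mul, mul_assoc]
    abel
  have hGam : HasDerivAt (fun t : ℝ => S.Gam (T + t • coordDir n i))
      (-(S.Gam T * (((S.σ : ℂ) ^ 2 * (d.2 : ℂ)) • S.D + dXi) * S.Gam T)) 0 := by
    have := hasDerivAt_matrix_inv ((hUD.const_smul ((S.σ : ℂ) ^ 2)).add hXi) (h.isUnit_inv_Gam _)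
    simp only [h.Gam_eq]
    refine this.congr_deriv ?_
    simp only [Pi.add_apply, Pi.smul_apply, hT0, smul_smul]
  have hGamt : HasDerivAt (fun t : ℝ => S.Gamt (T + t • coordDir n i))
      (-(S.Gamt T * (((S.σ : ℂ) ^ 2 * (d.1 : ℂ)) • S.Dt + dXit) * S.Gamt T)) 0 := by
    have := hasDerivAt_matrix_inv ((hUDt.const_smul ((S.σ : ℂ) ^ 2)).add hXit)
      (h.isUnit_inv_Gamt _)
    simp only [h.Gamt_eq]
    refine this.congr_deriv ?_
    simp only [Pi.add_apply, Pi.smul_apply, hT0, smul_smul]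
  set dGam := -(S.Gam T * (((S.σ : ℂ) ^ 2 * (d.2 : ℂ)) • S.D + dXi) * S.Gam T) with hdGam
  set dGamt := -(S.Gamt T * (((S.σ : ℂ) ^ 2 * (d.1 : ℂ)) • S.Dt + dXit) * S.Gamt T) with hdGamt
  -- The fixed-point equation holds at every position, so both sides may be differentiated along the
  -- line and compared by uniqueness of the derivative.
  have hfix1 : (d.1 : ℂ) = 1 / (M : ℂ) * (S.D * dGam).trace := by
    refine hδ.ofReal_comp.unique ?_
    have h1 := (traceCLM.hasFDerivAt.comp_hasDerivAt (0 : ℝ)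
      (hGam.const_mul S.D)).const_mul (1 / (M : ℂ))
    refine h1.congr_of_eventuallyEq (Filter.Eventually.of_forall fun t => ?_)
    exact (h.isPositiveSolution_fixedPoint _).2.2.1
  have hfix2 : (d.2 : ℂ) = 1 / (M : ℂ) * (S.Dt * dGamt).trace := by
    refine hδt.ofReal_comp.unique ?_
    have h1 := (traceCLM.hasFDerivAt.comp_hasDerivAt (0 : ℝ)
      (hGamt.const_mul S.Dt)).const_mul (1 / (M : ℂ))
    refine h1.congr_of_eventuallyEq (Filter.Eventually.of_forall fun t => ?_)
    exact (h.isPositiveSolution_fixedPoint _).2.2.2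
  refine ⟨d.1, d.2, dGam, dGamt, dPhi, dPhit, dXi, dXit,
    ⟨hδ, hδt, hasMatrixPartial_of_hasDerivAt hGam, hasMatrixPartial_of_hasDerivAt hGamt,
      hasMatrixPartial_of_hasDerivAt hPhi, hasMatrixPartial_of_hasDerivAt hPhit,
      hasMatrixPartial_of_hasDerivAt hXi, hasMatrixPartial_of_hasDerivAt hXit, fun m => ?_⟩,
    ⟨hfix1, hfix2, rfl, rfl, rfl, rfl, rfl, ?_⟩, ?_⟩
  · have := hasDerivAt_conjTranspose_GLoS (S := S) T n i m n
    rwa [Matrix.vecMulVec_apply, Pi.single_eq_same, mul_one] at this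
  · simp only [hdXit, hB', Matrix.mul_assoc]
  · have hσ0 : ((S.σ : ℂ) ^ 2) ≠ 0 := pow_ne_zero 2 (by exact_mod_cast h.sigma_pos.ne')
    have hpos : ∀ T', (((S.σ : ℂ) ^ 2) • S.Gam T').PosDef := fun T' => by
      have := posDef_ofReal_smul (h.posDef_Gam T') h.noise_pos
      rwa [Complex.ofReal_pow] at this
    have hl1 := hasDerivAt_log_det_re (hGam.const_smul ((S.σ : ℂ) ^ 2)) (hpos _)
    have hl2 := hasDerivAt_log_det_re hUDt (h.posDef_one_add_Dt (h.delta_pos _).le)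
    have hl3 := ((hδ.const_mul (S.σ ^ 2 * M)).mul hδt)
    have hr := (hl1.neg.add hl2).sub hl3
    refine ⟨_, hr, ?_⟩
    have e1 : (((S.σ : ℂ) ^ 2) • S.Gam T)⁻¹ * (((S.σ : ℂ) ^ 2) • dGam) =
        (S.Gam T)⁻¹ * dGam := by
      have e0 : (((S.σ : ℂ) ^ 2) • S.Gam T)⁻¹ = ((S.σ : ℂ) ^ 2)⁻¹ • (S.Gam T)⁻¹ :=
        Matrix.inv_smul' (S.Gam T) (Units.mk0 _ hσ0)
          ((Matrix.isUnit_iff_isUnit_det _).1 (h.posDef_Gam T).isUnit)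
      rw [e0, Matrix.smul_mul, Matrix.mul_smul, smul_smul, inv_mul_cancel₀ hσ0, one_smul]
    -- The rate has a real derivative while the formula is complex: its traces must be shown real.
    -- Here `dGam` is Hermitian as the derivative of a Hermitian curve.
    have i1 : ((S.Gam T)⁻¹ * dGam).trace.im = 0 :=
      trace_mul_im_eq_zero (h.posDef_Gam T).inv.isHermitian
        (isHermitian_of_hasDerivAt hGam fun _ => (h.posDef_Gam _).isHermitian)
    have i2 : (S.Phit T * S.Dt).trace.im = 0 :=
      trace_mul_im_eq_zero (h.posDef_Phit T).isHermitian
        (posSemidef_realDiag h.diagDt_nonneg).isHermitian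
    have e2 : (1 + (S.delta T : ℂ) • S.Dt)⁻¹ * ((d.1 : ℂ) • S.Dt) =
        (d.1 : ℂ) • (S.Phit T * S.Dt) := Matrix.mul_smul _ _ _
    simp only [Pi.smul_apply, hT0, e1, e2, Matrix.trace_smul, smul_eq_mul]
    apply Complex.ext
    · simp [i2, ← Complex.ofReal_pow]
      ring
    · simp [i1, i2, ← Complex.ofReal_pow]

/-- Fréchet differentiability supplies the gradient; pairing it with a basis vector is the line
derivative in that coordinate, which identifies each entry. -/
lemma exists_hasGradientAt_rate (h : S.Admissible) (T : Positions N) (n : Fin N) :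
    ∃ g : EuclideanSpace ℝ (Fin 2),
      HasGradientAt (fun t => S.rate (Function.update T n t)) g (T n) ∧
      ∀ i r, HasDerivAt (fun t : ℝ => S.rate (T + t • coordDir n i)) r 0 → g i = r := by
  have hupd : DifferentiableAt ℝ (fun t => Function.update T n t) (T n) := by
    refine differentiableAt_pi.2 fun n' => ?_
    by_cases hn : n' = n
    · subst hn; simp
    · simp [hn]
  have hr : DifferentiableAt ℝ S.rate (Function.update T n (T n)) := by
    rw [Function.update_eq_self]; exact h.differentiableAt_rate T
  obtain ⟨g, hg⟩ : ∃ g, HasGradientAt (fun t => S.rate (Function.update T n t)) g (T n) :=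
    ⟨_, (hr.comp (T n) hupd).hasGradientAt⟩
  refine ⟨g, hg, fun i r hd => ?_⟩
  have h1 : HasDerivAt (fun t : ℝ => T n + t • EuclideanSpace.single i (1 : ℝ))
      (EuclideanSpace.single i (1 : ℝ)) 0 := by
    simpa using ((hasDerivAt_id (0 : ℝ)).smul_const (EuclideanSpace.single i (1 : ℝ))).const_add
      (T n)
  have hf := hg.hasFDerivAt
  -- The chain rule needs the base point written as the value of the line at 0.
  have h0 : T n = T n + (0 : ℝ) • EuclideanSpace.single i (1 : ℝ) := by simp
  rw [h0] at hf
  have h2 := hf.comp_hasDerivAt (0 : ℝ) h1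
  simp only [Function.comp_def, update_add_smul_single] at h2
  rw [hd.unique h2]
  simp [EuclideanSpace.inner_single_right]

end Admissible

end System

end MIMOME

end

theorem proposition3 {N M : ℕ} (S : MIMOME.System N M)
    (hlam : 0 < S.lam) (hσ : 0 < S.σ) (hβ : ∀ m, 0 < S.β m) (hK : ∀ m, 0 ≤ S.K m)
    (hF : S.F ≠ 0) :
    (∀ T : MIMOME.Positions N, ∃! p : ℝ × ℝ, S.IsPositiveSolution T p) ∧
    ∀ (T : MIMOME.Positions N) (n : Fin N),
      ∃ (dδ dδt : Fin 2 → ℝ)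
        (dGam dGamt dPhi dPhit dXi dXit : Fin 2 → Matrix (Fin M) (Fin M) ℂ),
        -- the partial derivatives exist
        (∀ i : Fin 2,
          HasLineDerivAt ℝ S.delta (dδ i) T (MIMOME.coordDir n i) ∧
          HasLineDerivAt ℝ S.deltat (dδt i) T (MIMOME.coordDir n i) ∧
          MIMOME.HasMatrixPartial S.Gam (dGam i) T n i ∧
          MIMOME.HasMatrixPartial S.Gamt (dGamt i) T n i ∧
          MIMOME.HasMatrixPartial S.Phi (dPhi i) T n i ∧
          MIMOME.HasMatrixPartial S.Phit (dPhit i) T n i ∧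
          MIMOME.HasMatrixPartial S.Xi (dXi i) T n i ∧
          MIMOME.HasMatrixPartial S.Xit (dXit i) T n i ∧
          (∀ m, HasLineDerivAt ℝ (fun T' => (S.GLoS T').conjTranspose m n)
            (S.gtDeriv T n i m) T (MIMOME.coordDir n i))) ∧
        -- they satisfy the differentiated fixed-point system
        (∀ i : Fin 2,
          (dδ i : ℂ) = 1 / (M : ℂ) * (S.D * dGam i).trace ∧
          (dδt i : ℂ) = 1 / (M : ℂ) * (S.Dt * dGamt i).trace ∧
          dGam i = -(S.Gam T * (((S.σ : ℂ) ^ 2 * (dδt i : ℂ)) • S.D + dXi i) * S.Gam T) ∧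
          dGamt i = -(S.Gamt T * (((S.σ : ℂ) ^ 2 * (dδ i : ℂ)) • S.Dt + dXit i) * S.Gamt T) ∧
          dPhi i = -(S.Phi T * ((dδt i : ℂ) • S.D) * S.Phi T) ∧
          dPhit i = -(S.Phit T * ((dδ i : ℂ) • S.Dt) * S.Phit T) ∧
          dXi i = S.B T * dPhit i * (S.B T).conjTranspose
            + MIMOME.twoRe (S.sqrtLambda *
                Matrix.vecMulVec (S.gtDeriv T n i) (Pi.single n (1 : ℂ)) *
                S.F * S.Phit T * (S.B T).conjTranspose) ∧
          dXit i = (S.B T).conjTranspose * dPhi i * S.B T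
            + MIMOME.twoRe ((S.B T).conjTranspose * S.Phi T * S.sqrtLambda *
                Matrix.vecMulVec (S.gtDeriv T n i) (Pi.single n (1 : ℂ)) * S.F)) ∧
        -- the gradient of the deterministic equivalent with respect to the `n`-th position
        ∃ g : EuclideanSpace ℝ (Fin 2),
          HasGradientAt (fun t => S.rate (Function.update T n t)) g (T n) ∧
          ∀ i : Fin 2,
            (g i : ℂ) = -((S.Gam T)⁻¹ * dGam i).trace
              + (dδ i : ℂ) * (S.Phit T * S.Dt).trace
              - (S.σ : ℂ) ^ 2 * (M : ℂ) *
                  ((dδ i : ℂ) * (S.deltat T : ℂ) + (S.delta T : ℂ) * (dδt i : ℂ)) := by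
  have h : S.Admissible := ⟨hσ, hβ, hK, hF⟩
  refine ⟨h.existsUnique_isPositiveSolution, fun T n => ?_⟩
  choose dδ dδt dGam dGamt dPhi dPhit dXi dXit hpart hsys r hr hrate using
    fun i => h.exists_partials T n i
  obtain ⟨g, hg, hgi⟩ := h.exists_hasGradientAt_rate T n
  refine ⟨dδ, dδt, dGam, dGamt, dPhi, dPhit, dXi, dXit, hpart, hsys, g, hg, fun i => ?_⟩
  rw [hgi i (r i) (hr i)]
  exact hrate i
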